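/- **Setting.** Let $R$ be a finite, principal, commutative local ring in which $2$ is invertible (for instance of odd prime characteristic), with maximal ideal $\mathfrak m=Rx$ of nilpotency degree $\ell\ge 1$ and residue field of order $q$. Let $A=R[y]=R\oplus Ry$ with $y^2=x$, with the involution $(r+sy)^*=r-sy$, put $\mathfrak r=Ay$ and $\mathfrak i=\mathfrak r^{\ell}$. Let $V$ be a free $A$-module of finite rank $m\ge 1$, $h:V\times V\to A$ a non-degenerate $*$-hermitian form ($A$-linear in the second variable), and $U$ its unitary group. Let $\lambda:R^+\to\mathbb C^\times$ be a primitive linear character (its kernel contains no non-zero ideal) and let $\mu:A^+\to\mathbb C^\times$, $\mu(r+sy)=\lambda(2s)$. Put $V_0=\mathfrak iV$. Let $H=A\times V$ be the Heisenberg group with $(a,v)(b,w)=(a+b+h(v,w),v+w)$, on which $U$ acts by ${}^g(a,v)=(a,gv)$. The Weil module is $X=\mathrm{ind}_{(A,V_0)\rtimes U}^{H\rtimes U}\,\mathbb C\zeta$, regarded as a $U$-module, where $(a,u)g\,\zeta=\mu(a)\zeta$; let $e_v=(0,v)\otimes\zeta$ for $v\in V$. Let $T$ be a transversal for $V_0$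 in $V$; then $(e_v)_{v\in T}$ is a basis of $X$, and $ge_v=\mu(h(gv,v'))e_{v'}$ if $g\in U$, $v,v'\in T$ and $gv\equiv v' \bmod V_0$. A vector $v\in V$ is primitive if $v\notin\mathfrak rV$. Let $Top$ be the span of all $e_v$ with $v\in T$ primitive. Let $S\subseteq T$ be a set of representatives of the primitive vectors for the relation $v\sim w\iff gv\equiv w \bmod V_0$ for some $g\in U$. Let $N=\{z\in A^\times: zz^*=1\}$, acting on $V$ by scalars, so that $N\subseteq U$, and let $G$ be the group of linear characters of $N$ that are trivial on $N\cap(1+\mathfrak i)$. Let $\iota\in N$ be the central involution $v\mapsto -v$ of $U$. For $s\in S$ let $C(s)=\{g\in U: gs\equiv s\bmod V_0\}$ and let $\delta_s:N\to\mathbb C^\times$ be a linear character extending the linear character $g\mapsto\mu(h(gs,s))$ of $C(s)\cap N$. For $\phi\in G$ let $Top(\phi,s)$ be the $U$-submodule of $X$ generated by $E_{\phi,s}=\sum_{z\in N}\phi(z^{-1})\delta_s(z^{-1})\,z e_s$. **Theorem.** Such extensions $\delta_s$ exist, and they can be chosen with $\delta_s(\iota)=1$ for all $s\in S$. For every choice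 of the $\delta_s$ the following hold. (a) $Top$ is a $U$-submodule of $X$, it is multiplicity free, and $$Top=\bigoplus_{s\in S}\bigoplus_{\phi\in G}Top(\phi,s),$$ where every $Top(\phi,s)$ is irreducible and monomial (induced from a linear character of a subgroup of $U$). (b) The eigenspaces $Top^{+}$ and $Top^{-}$ of $\iota$ acting on $Top$, for the eigenvalues $1$ and $-1$, are $U$-submodules, $Top=Top^+\oplus Top^-$, and $$\dim Top^+=\dim Top^-=\frac{q^{\ell m}-q^{(\ell-1)m}}{2}.$$ If $\delta_s(\iota)=1$ for all $s\in S$, then $$Top^{\pm}=\bigoplus_{s\in S}\ \bigoplus_{\phi\in G,\ \phi(\iota)=\pm1}Top(\phi,s).$$ For an arbitrary choice of the $\delta_s$, $Top^{\pm}$ is the direct sum of the $Top(\phi,s)$ with $s\in S$, $\phi\in G$ and $\phi(\iota)\delta_s(\iota)=\pm1$. -/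

import Mathlib

noncomputable section

namespace RamifiedWeil

universe u v

/-- The ramified quadratic extension `A = R[y] = R ⊕ R y`, `y ^ 2 = x`. The element `r + s y` is
`⟨r, s⟩`, the element `y` is `QuadraticAlgebra.omega`, and `star (r + s y) = r - s y`. -/
abbrev RamExt (R : Type u) [CommRing R] (x : R) : Type u := QuadraticAlgebra R x 0

/-- The data fixed throughout: a generator `x` of the maximal ideal `𝔪` of the local ring `R`, the
nilpotency degree `ℓ` of `𝔪`, a non-degenerate hermitian form `h` on the `A`-module `V` (linear in
the second variable), and a primitive linear character `lam` of the additive group of `R`. -/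
structure WeilData (R : Type u) [CommRing R] [IsLocalRing R] (x : R)
    (V : Type v) [AddCommGroup V] [Module (RamExt R x) V] where
  gen : IsLocalRing.maximalIdeal R = Ideal.span {x}
  ell : ℕ
  nilpotency : IsLeast {k : ℕ | IsLocalRing.maximalIdeal R ^ k = ⊥} ell
  h : V →ₛₗ[starRingEnd (RamExt R x)] V →ₗ[RamExt R x] RamExt R x
  hermitian : ∀ u v : V, h v u = star (h u v)
  nondegenerate : Function.Bijective (fun v : V => h v)
  lam : AddChar R ℂ
  primitive : lam.IsPrimitive

/-- The one-dimensional representation attached to a linear character. -/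
def linearRep {G : Type*} [Group G] (χ : G →* ℂˣ) : Representation ℂ G ℂ where
  toFun g := (χ g : ℂ) • LinearMap.id
  map_one' := by ext; simp
  map_mul' a b := by ext; simp [mul_comm]

/-- A complex representation is monomial if it is induced from a linear character of a
subgroup. -/
def IsMonomial {G W : Type*} [Group G] [AddCommGroup W] [Module ℂ W]
    (ρ : Representation ℂ G W) : Prop :=
  ∃ (B : Subgroup G) (χ : B →* ℂˣ),
    Nonempty (ρ.Equiv (Representation.ind B.subtype (linearRep χ)))

/-- A representation is multiplicity free if isomorphic irreducible subrepresentations are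
equal. -/
def IsMultiplicityFree {G W : Type*} [Group G] [AddCommGroup W] [Module ℂ W]
    (ρ : Representation ℂ G W) : Prop :=
  ∀ W₁ W₂ : Subrepresentation ρ, W₁.toRepresentation.IsIrreducible →
    W₂.toRepresentation.IsIrreducible →
    Nonempty (W₁.toRepresentation.Equiv W₂.toRepresentation) → W₁ = W₂

/-- The subrepresentation generated by a vector. -/
def generated {G W : Type*} [Group G] [AddCommGroup W] [Module ℂ W]
    (ρ : Representation ℂ G W) (w : W) : Subrepresentation ρ where
  toSubmodule := Submodule.span ℂ (Set.range fun g : G => ρ g w)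
  apply_mem_toSubmodule g := fun u hu => by
    induction hu using Submodule.span_induction with
    | mem u hu =>
      obtain ⟨k, rfl⟩ := hu
      exact Submodule.subset_span ⟨g * k, by simp⟩
    | zero => simp
    | add a b _ _ ha hb => simpa using Submodule.add_mem _ ha hb
    | smul c a _ ha => simpa using Submodule.smul_mem _ c ha

/-- `M` is the internal direct sum of the family `F` of its subspaces. -/
def IsInternalSum {ι W : Type*} [AddCommGroup W] [Module ℂ W]
    (F : ι → Submodule ℂ W) (M : Submodule ℂ W) : Prop :=
  iSupIndep F ∧ ⨆ i, F i = M

namespace WeilData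

variable {R : Type u} [CommRing R] [IsLocalRing R] {x : R}
  {V : Type v} [AddCommGroup V] [Module (RamExt R x) V] (D : WeilData R x V)

/-- The linear character `a ↦ lam (d a)` of `A`, where `d (r + s y) = 2 s`. -/
def mu : AddChar (RamExt R x) ℂ where
  toFun a := D.lam (2 * a.im)
  map_zero_eq_one' := by simp
  map_add_eq_mul' a b := by simp [mul_add, AddChar.map_add_eq_mul]

/-- The maximal ideal `𝔯 = A y`. -/
def rad (_D : WeilData R x V) : Ideal (RamExt R x) := Ideal.span {QuadraticAlgebra.omega}

/-- The ideal `𝔦 = 𝔯 ^ ℓ`. -/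
def idealI : Ideal (RamExt R x) := D.rad ^ D.ell

/-- The submodule `V₀ = 𝔦 V`. -/
def V0 : Submodule (RamExt R x) V := D.idealI • ⊤

/-- A vector is primitive if it does not lie in `𝔯 V`. -/
def IsPrimitiveVec (v : V) : Prop := v ∉ (D.rad • ⊤ : Submodule (RamExt R x) V)

lemma idealI_mul_self : D.idealI * D.idealI = ⊥ := by
  have hx : x ^ D.ell = 0 := by
    have h1 := D.nilpotency.1
    change IsLocalRing.maximalIdeal R ^ D.ell = ⊥ at h1
    rw [D.gen, Ideal.span_singleton_pow] at h1
    simpa using h1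
  have hω : (QuadraticAlgebra.omega : RamExt R x) * QuadraticAlgebra.omega
      = algebraMap R (RamExt R x) x := by
    ext <;> simp
  rw [idealI, rad, ← mul_pow, Ideal.span_singleton_mul_span_singleton, Ideal.span_singleton_pow,
    hω, ← map_pow, hx]
  simp

lemma h_left_mem {J : Ideal (RamExt R x)} (hJ : ∀ a ∈ J, star a ∈ J) {u : V}
    (hu : u ∈ (J • ⊤ : Submodule (RamExt R x) V)) (w : V) : D.h u w ∈ J := by
  induction hu using Submodule.smul_induction_on' with
  | smul a ha n _ =>
    simp only [map_smulₛₗ, LinearMap.smul_apply, smul_eq_mul]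
    exact J.mul_mem_right _ (hJ a ha)
  | add a _ b _ h1 h2 => simpa using J.add_mem h1 h2

lemma star_mem_idealI : ∀ a ∈ D.idealI, star a ∈ D.idealI := by
  intro a ha
  rw [idealI, rad, Ideal.span_singleton_pow, Ideal.mem_span_singleton'] at ha ⊢
  obtain ⟨c, rfl⟩ := ha
  have hs : star (QuadraticAlgebra.omega : RamExt R x) = -QuadraticAlgebra.omega := by
    ext <;> simp
  refine ⟨star c * (-1) ^ D.ell, ?_⟩
  rw [star_mul, star_pow, hs, neg_pow]
  ring

lemma h_V0_V0 {u w : V} (hu : u ∈ D.V0) (hw : w ∈ D.V0) : D.h u w = 0 := by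
  have h1 : D.h u w ∈ D.idealI * D.idealI := by
    refine Submodule.smul_induction_on (p := fun w => D.h u w ∈ D.idealI * D.idealI) hw ?_ ?_
    · intro a ha n _
      rw [map_smul, smul_eq_mul]
      exact Ideal.mul_mem_mul ha (D.h_left_mem D.star_mem_idealI hu n)
    · intro a b ha hb
      rw [map_add]
      exact add_mem ha hb
  rw [idealI_mul_self] at h1
  simpa using h1

/-- The unitary group of `h`. -/
def unitaryGroup : Subgroup (V ≃ₗ[RamExt R x] V) where
  carrier := {g | ∀ u v : V, D.h (g u) (g v) = D.h u v}
  one_mem' := by intro u v; rfl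
  mul_mem' {a b} ha hb := by
    intro u v
    rw [LinearEquiv.mul_apply, LinearEquiv.mul_apply, ha, hb]
  inv_mem' {a} ha := by
    intro u v
    have h1 := ha (a⁻¹ u) (a⁻¹ v)
    rw [← LinearEquiv.mul_apply, ← LinearEquiv.mul_apply, mul_inv_cancel] at h1
    exact h1.symm

lemma smul_mem_V0 (g : V ≃ₗ[RamExt R x] V) {u : V} (hu : u ∈ D.V0) : g u ∈ D.V0 := by
  have h1 : (D.V0).map (g : V →ₗ[RamExt R x] V) ≤ D.V0 := by
    rw [V0, Submodule.map_smul'']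
    exact Submodule.smul_mono le_rfl le_top
  exact h1 (Submodule.mem_map_of_mem hu)

/-- The Heisenberg group: pairs `(a, v)`, with `(a, v) (b, w) = (a + b + h v w, v + w)`. -/
@[ext]
structure Heis (D : WeilData R x V) where
  scal : RamExt R x
  vec : V

instance : Group (Heis D) where
  mul p q := ⟨p.scal + q.scal + D.h p.vec q.vec, p.vec + q.vec⟩
  one := ⟨0, 0⟩
  inv p := ⟨-p.scal + D.h p.vec p.vec, -p.vec⟩
  mul_assoc p q r := by
    apply Heis.ext
    · change p.scal + q.scal + D.h p.vec q.vec + r.scal + D.h (p.vec + q.vec) r.vec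
        = p.scal + (q.scal + r.scal + D.h q.vec r.vec) + D.h p.vec (q.vec + r.vec)
      simp only [map_add, LinearMap.add_apply]
      ring
    · exact add_assoc _ _ _
  one_mul p := by
    apply Heis.ext
    · change 0 + p.scal + D.h 0 p.vec = p.scal
      simp
    · exact zero_add _
  mul_one p := by
    apply Heis.ext
    · change p.scal + 0 + D.h p.vec 0 = p.scal
      simp
    · exact add_zero _
  inv_mul_cancel p := by
    apply Heis.ext
    · change -p.scal + D.h p.vec p.vec + p.scal + D.h (-p.vec) p.vec = 0
      simp
    · exact neg_add_cancel _

lemma Heis.mul_def (p q : Heis D) :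
    p * q = ⟨p.scal + q.scal + D.h p.vec q.vec, p.vec + q.vec⟩ := rfl

/-- The action `(a, v) ↦ (a, g v)` of the unitary group on the Heisenberg group. -/
def heisAction : D.unitaryGroup →* MulAut (Heis D) where
  toFun g :=
    { toFun := fun p => ⟨p.scal, g.1 p.vec⟩
      invFun := fun p => ⟨p.scal, g.1.symm p.vec⟩
      left_inv := fun p => by simp
      right_inv := fun p => by simp
      map_mul' := fun p q => by
        simp only [Heis.mul_def, map_add, g.2 p.vec q.vec] }
  map_one' := rfl
  map_mul' _ _ := rfl

/-- The semidirect product `H ⋊ U`. -/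
abbrev Big : Type (max u v) := Heis D ⋊[D.heisAction] D.unitaryGroup

/-- The subgroup `(A, V₀) ⋊ U` of `H ⋊ U`. -/
def smallSubgroup : Subgroup D.Big where
  carrier := {k | k.left.vec ∈ D.V0}
  one_mem' := D.V0.zero_mem
  mul_mem' {a _} ha hb := D.V0.add_mem ha (D.smul_mem_V0 a.2.1 hb)
  inv_mem' {a} ha := D.smul_mem_V0 (a.2⁻¹).1 (D.V0.neg_mem ha)

/-- The linear character `((a, u), g) ↦ mu a` of `(A, V₀) ⋊ U`. -/
def smallChar : D.smallSubgroup →* ℂˣ :=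
  MonoidHom.toHomUnits
    { toFun := fun k => D.mu k.1.left.scal
      map_one' := D.mu.map_zero_eq_one
      map_mul' := fun k l => by
        have h0 : D.h k.1.left.vec (k.1.right.1 l.1.left.vec) = 0 :=
          D.h_V0_V0 k.2 (D.smul_mem_V0 _ l.2)
        change D.mu (k.1.left.scal + l.1.left.scal
          + D.h k.1.left.vec (k.1.right.1 l.1.left.vec)) = _
        rw [h0, add_zero, AddChar.map_add_eq_mul] }

/-- The underlying space `X` of the module induced from `(A, V₀) ⋊ U` to `H ⋊ U`. -/
abbrev X : Type (max u v) :=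
  Representation.IndV D.smallSubgroup.subtype (linearRep D.smallChar)

/-- The Weil representation of `U`: the restriction to `U` of the induced module `X`. -/
def weil : Representation ℂ D.unitaryGroup D.X :=
  (Representation.ind D.smallSubgroup.subtype (linearRep D.smallChar)).comp
    SemidirectProduct.inr

/-- The vector `e_v = (0, v) ⊗ ζ` of `X`. In Mathlib's induced module the group acts by right
translation by inverses, so that `k ⊗ ζ` is the class of `k⁻¹`. -/
def e (v : V) : D.X :=
  Representation.IndV.mk D.smallSubgroup.subtype (linearRep D.smallChar)
    (SemidirectProduct.inl (⟨0, v⟩ : Heis D))⁻¹ (1 : ℂ)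

/-- The group `N` of elements of norm one of `A`. -/
abbrev NormOne (_D : WeilData R x V) : Type u := unitary (RamExt R x)

/-- The embedding of `N` in the unitary group as scalar multiplications. -/
def scalar : D.NormOne →* D.unitaryGroup where
  toFun z :=
    ⟨{ toFun := fun v => (z : RamExt R x) • v
       invFun := fun v => (star z : RamExt R x) • v
       map_add' := fun a b => smul_add _ _ _
       map_smul' := fun a b => smul_comm _ _ _
       left_inv := fun a => by
        change star (z : RamExt R x) • (z : RamExt R x) • a = a
        rw [smul_smul, Unitary.coe_star_mul_self, one_smul]
       right_inv := fun a => by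
        change (z : RamExt R x) • star (z : RamExt R x) • a = a
        rw [smul_smul, Unitary.mul_star_self_of_mem z.2, one_smul] },
     fun a b => by
      change D.h ((z : RamExt R x) • a) ((z : RamExt R x) • b) = D.h a b
      rw [map_smul, map_smulₛₗ, LinearMap.smul_apply, smul_smul, starRingEnd_apply,
        Unitary.mul_star_self_of_mem z.2, one_smul]⟩
  map_one' := by
    apply Subtype.ext
    apply LinearEquiv.ext
    intro a
    exact one_smul _ a
  map_mul' z w := by
    apply Subtype.ext
    apply LinearEquiv.ext
    intro a
    exact mul_smul _ _ a

/-- The central involution `ι : v ↦ -v`, that is, the scalar `-1 ∈ N`. -/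
def iota : D.unitaryGroup := D.scalar (-1)

/-- The group `C(v)` of all `g ∈ U` with `g v ≡ v` modulo `V₀`. -/
def stab (v : V) : Subgroup D.unitaryGroup where
  carrier := {g | g.1 v - v ∈ D.V0}
  one_mem' := by
    change v - v ∈ D.V0
    simp
  mul_mem' {a b} ha hb := by
    have h1 := D.V0.add_mem (D.smul_mem_V0 a.1 hb) ha
    rw [map_sub, sub_add_sub_cancel] at h1
    exact h1
  inv_mem' {a} ha := by
    have h1 := D.V0.neg_mem (D.smul_mem_V0 (a⁻¹).1 ha)
    have h2 : (a⁻¹).1 (a.1 v) = v := a.1.symm_apply_apply v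
    rw [map_sub, h2, neg_sub] at h1
    exact h1

/-- `β_v g = mu (h (g v) v)`, which on `C(v)` is a linear character. -/
def beta (v : V) (g : D.unitaryGroup) : ℂ := D.mu (D.h (g.1 v) v)

/-- The linear character `δ` of `N` extends the restriction of `β_v` to `C(v) ∩ N`. -/
def Extends (v : V) (δ : D.NormOne →* ℂˣ) : Prop :=
  ∀ z : D.NormOne, D.scalar z ∈ D.stab v → (δ z : ℂ) = D.beta v (D.scalar z)

/-- The group `G` of linear characters of `N` that are trivial on `N ∩ (1 + 𝔦)`. -/
def charGroup : Subgroup (D.NormOne →* ℂˣ) where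
  carrier := {φ | ∀ z : D.NormOne, (z : RamExt R x) - 1 ∈ D.idealI → φ z = 1}
  one_mem' := fun _ _ => rfl
  mul_mem' {a b} ha hb := fun z hz => by
    rw [MonoidHom.mul_apply, ha z hz, hb z hz, one_mul]
  inv_mem' {a} ha := fun z hz => by
    rw [MonoidHom.inv_apply, ha z hz, inv_one]

/-- `T` is a transversal for `V₀` in `V`. -/
def IsTransversal (T : Set V) : Prop := ∀ v : V, ∃! t : V, t ∈ T ∧ v - t ∈ D.V0

/-- `v ∼ w` if `g v ≡ w` modulo `V₀` for some `g ∈ U`. -/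
def Sim (v w : V) : Prop := ∃ g : D.unitaryGroup, g.1 v - w ∈ D.V0

/-- `S` is a set of representatives for `∼` on the set of primitive vectors. -/
def IsRepSet (S : Set V) : Prop :=
  (∀ s ∈ S, D.IsPrimitiveVec s) ∧
    ∀ v : V, D.IsPrimitiveVec v → ∃! s : V, s ∈ S ∧ D.Sim v s

/-- `Top`: the span of all `e_v` with `v ∈ T` primitive. -/
def topSpace (T : Set V) : Submodule ℂ D.X :=
  Submodule.span ℂ (D.e '' {v | v ∈ T ∧ D.IsPrimitiveVec v})

/-- The eigenspace of `ι` acting on `Top` for the eigenvalue `c`. -/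
def topEigen (T : Set V) (c : ℂ) : Submodule ℂ D.X :=
  D.topSpace T ⊓ Module.End.eigenspace (D.weil D.iota) c

/-- `E_{φ,v} = ∑_{z ∈ N} φ(z⁻¹) γ_v(z⁻¹) z e_v`. Here `γ_v (g z) = β_v(g) δ(z)` for `g ∈ C(v)` and
`z ∈ N`, so that `γ_v` is `δ` on `N`. -/
def E (δ φ : D.NormOne →* ℂˣ) (v : V) : D.X :=
  ∑ᶠ z : D.NormOne, ((φ z⁻¹ : ℂ) * (δ z⁻¹ : ℂ)) • D.weil (D.scalar z) (D.e v)

/-- `Top(φ, v)`: the `U`-submodule generated by `E_{φ,v}`. -/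
def topSub (δ φ : D.NormOne →* ℂˣ) (v : V) : Subrepresentation D.weil :=
  generated D.weil (D.E δ φ v)

end WeilData

end RamifiedWeil

end

/-! The unitary group permutes the lines spanned by the `e_v`, and `N` is central in it. Projecting
`e_s` onto its `N`-eigenspaces therefore gives vectors `E_{φ,s}` whose lines are again permuted by
`U`. Up to scalars, the translates of all `E_{φ,s}` are indexed by pairs of an `N`-orbit of
primitive vectors modulo `V₀` and a character `φ ∈ G`.

The decisive point is that these lines carry distinct characters of a group acting diagonally on
them. An element `g` congruent to `1` modulo `𝔦` acts on the line belonging to `v` by `μ(h(gv,v))`,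
and `z ∈ N` acts by `φ(z)δ_s(z)`. Elements `1 + k`, with `k` skew-hermitian of rank at most two and
values in `V₀`, show that the first character determines the products `h(v,p)h(q,v)` modulo `𝔦`
(`h_mul_h_sub_mem_idealI`). If `v` and `w` give the same products, evaluation at `p` with `h(w,p) =
1` yields `w ≡ av` with `aa* ≡ 1`; as `𝔦² = 0` and `2` is invertible, `a` can be corrected to an
element of `N` (`exists_congruence_beta_ne`). For one orbit, different `φ` are told apart by `N`
itself.

The rest is formal and is proved for any `MonomialSystem`: an invariant subspace contains every
vector of the system that occurs in one of its elements. Hence orbits of lines generate irreducible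
monomial modules, their sum is direct, and the sum is multiplicity free because an isomorphism
preserves the separating eigenvalues. The system spans `Top`, since summing `E_{φ,s}` over `φ ∈ G`
returns a non-zero multiple of `e_s` (`exists_sum_E`).

For `ι`, each line is an eigenline with value `φ(-1)δ_s(-1) = ±1`. Some character in `G` takes the
value `-1` at `-1`, and multiplication by it exchanges the two signs, so the eigenspaces have equal
dimension. Together they have dimension `|V/V₀| - |𝔯V/V₀|`. -/

noncomputable section

namespace RamifiedWeil

/-! ### Modules induced from a linear character. -/

section Induced

variable {G : Type*} [Group G] {B : Subgroup G} (χ : B →* ℂˣ)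

lemma linearRep_apply {G : Type*} [Group G] (χ : G →* ℂˣ) (g : G) (a : ℂ) :
    linearRep χ g a = (χ g : ℂ) * a := rfl

/-- Coinvariants identify the class of `(b * g, χ b * a)` with that of `(g, a)`; pulling out the
scalar produces the inverse. -/
lemma indMk_mul (b : B) (g : G) (a : ℂ) :
    Representation.IndV.mk B.subtype (linearRep χ) (b * g) a
      = ((χ b)⁻¹ : ℂˣ) • Representation.IndV.mk B.subtype (linearRep χ) g a := by
  have h := Representation.Coinvariants.mk_self_apply
    (ρ := Representation.tprod ((Representation.leftRegular ℂ G).comp B.subtype) (linearRep χ))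
    b (MonoidAlgebra.single g 1 ⊗ₜ a)
  have h1 : Representation.IndV.mk B.subtype (linearRep χ) (b * g) ((χ b : ℂ) * a)
      = Representation.IndV.mk B.subtype (linearRep χ) g a := by
    simpa [linearRep_apply] using h
  have h2 := map_smul (Representation.IndV.mk B.subtype (linearRep χ) (b * g)) (χ b : ℂ) a
  rw [← h1, ← smul_eq_mul (χ b : ℂ) a, h2, Units.smul_def, smul_smul, ← Units.val_mul,
    inv_mul_cancel, Units.val_one, one_smul]

/-- The linear map on an induced module determined by a `B`-equivariant function on `G`. -/
def indLift {W : Type*} [AddCommGroup W] [Module ℂ W] (f : G → W)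
    (hf : ∀ (b : B) (g : G), (χ b : ℂ) • f (b * g) = f g) :
    Representation.IndV B.subtype (linearRep χ) →ₗ[ℂ] W :=
  Representation.Coinvariants.lift _
    (TensorProduct.lift <|
      (Finsupp.lift (ℂ →ₗ[ℂ] W) ℂ G fun g => LinearMap.toSpanSingleton ℂ W (f g)) ∘ₗ
      (MonoidAlgebra.coeffLinearEquiv ℂ).toLinearMap)
    fun b => by
      ext g
      simp [linearRep_apply, hf]

lemma indLift_mk {W : Type*} [AddCommGroup W] [Module ℂ W] (f : G → W)
    (hf : ∀ (b : B) (g : G), (χ b : ℂ) • f (b * g) = f g) (g : G) (a : ℂ) :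
    indLift χ f hf (Representation.IndV.mk B.subtype (linearRep χ) g a) = a • f g := by
  simp [indLift]

end Induced

/-! ### Subrepresentations, stabilizers of lines and monomiality. -/

section Subrep

variable {G W : Type*} [Group G] [AddCommGroup W] [Module ℂ W] {ρ : Representation ℂ G W}

/-- Allows irreducibility to be tested on invariant subspaces of the ambient space, so that no
subrepresentation of a subrepresentation is needed later. -/
lemma isIrreducible_of_forall_le (τ : Subrepresentation ρ) (h0 : τ.toSubmodule ≠ ⊥)
    (h : ∀ M : Submodule ℂ W, (∀ g, ∀ w ∈ M, ρ g w ∈ M) → M ≤ τ.toSubmodule → M ≠ ⊥ →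
      τ.toSubmodule ≤ M) : τ.toRepresentation.IsIrreducible := by
  have hbt : (⊥ : Subrepresentation τ.toRepresentation) ≠ ⊤ := by
    intro hbt
    obtain ⟨w, hw, hw0⟩ := Submodule.exists_mem_ne_zero_of_ne_bot h0
    have h1 : (⟨w, hw⟩ : τ.toSubmodule) ∈ (⊥ : Submodule ℂ τ.toSubmodule) := by
      have h2 : (⊤ : Submodule ℂ τ.toSubmodule) = ⊥ :=
        (congrArg Subrepresentation.toSubmodule hbt).symm
      rw [← h2]
      trivial
    rw [Submodule.mem_bot] at h1
    exact hw0 (congrArg Subtype.val h1)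
  refine { exists_pair_ne := ⟨⊥, ⊤, hbt⟩, eq_bot_or_eq_top := fun σ => ?_ }
  by_cases hσ : σ.toSubmodule = ⊥
  · left
    exact Subrepresentation.toSubmodule_injective hσ
  · right
    apply Subrepresentation.toSubmodule_injective
    have h1 := h (σ.toSubmodule.map τ.toSubmodule.subtype) (by
      rintro g _ ⟨w, hw, rfl⟩
      exact ⟨τ.toRepresentation g w, σ.apply_mem_toSubmodule g hw, rfl⟩)
      (Submodule.map_subtype_le _ _) (by
        intro h0
        refine hσ (Submodule.map_injective_of_injective τ.toSubmodule.injective_subtype ?_)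
        rw [h0, Submodule.map_bot])
    refine eq_top_iff.mpr fun w _ => ?_
    obtain ⟨w', hw', hww⟩ := h1 w.2
    have : w' = w := Subtype.ext hww
    exact this ▸ hw'

/-- The intersection is a non-zero invariant subspace of the irreducible `W₁`, hence all of it. -/
lemma le_of_isIrreducible (W₁ W₂ : Subrepresentation ρ)
    (h : W₁.toRepresentation.IsIrreducible) {w : W} (hw1 : w ∈ W₁.toSubmodule)
    (hw2 : w ∈ W₂.toSubmodule) (hw : w ≠ 0) : W₁.toSubmodule ≤ W₂.toSubmodule := by
  let σ : Subrepresentation W₁.toRepresentation :=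
    { toSubmodule := W₂.toSubmodule.comap W₁.toSubmodule.subtype
      apply_mem_toSubmodule := fun g v hv => W₂.apply_mem_toSubmodule g hv }
  rcases h.eq_bot_or_eq_top σ with h1 | h1
  · exfalso
    have h2 : (⟨w, hw1⟩ : W₁.toSubmodule) ∈ σ.toSubmodule := hw2
    rw [h1] at h2
    exact hw (congrArg Subtype.val ((Submodule.mem_bot ℂ).mp h2))
  · intro v hv
    have h2 : (⟨v, hv⟩ : W₁.toSubmodule) ∈ (⊤ : Submodule ℂ W₁.toSubmodule) := trivial
    have h3 : σ.toSubmodule = ⊤ := congrArg Subrepresentation.toSubmodule h1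
    rw [← h3] at h2
    exact h2

lemma mem_generated (w : W) (g : G) : ρ g w ∈ (generated ρ w).toSubmodule :=
  Submodule.subset_span ⟨g, rfl⟩

/-- The stabilizer of the line spanned by a non-zero vector. -/
def lineStabilizer (ρ : Representation ℂ G W) {w : W} (hw : w ≠ 0) : Subgroup G where
  carrier := {g | ∃ c : ℂ, ρ g w = c • w}
  one_mem' := ⟨1, by simp⟩
  mul_mem' := by
    rintro a b ⟨c, hc⟩ ⟨d, hd⟩
    exact ⟨d * c, by simp [hc, hd, mul_smul]⟩
  inv_mem' := by
    rintro a ⟨c, hc⟩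
    have hc0 : c ≠ 0 := by
      rintro rfl
      have h1 := congrArg (ρ a⁻¹) hc
      simp [← Module.End.mul_apply, ← map_mul, hw] at h1
    refine ⟨c⁻¹, ?_⟩
    have h1 := congrArg (fun u => c⁻¹ • ρ a⁻¹ u) hc
    simpa [← Module.End.mul_apply, ← map_mul, smul_smul, hc0] using h1.symm

/-- The scalar by which an element of the stabilizer of a line acts on it. -/
def lineScalar (ρ : Representation ℂ G W) {w : W} (hw : w ≠ 0) (b : lineStabilizer ρ hw) : ℂ :=
  b.2.choose

lemma lineScalar_spec {w : W} (hw : w ≠ 0) (b : lineStabilizer ρ hw) :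
    ρ b w = lineScalar ρ hw b • w := b.2.choose_spec

/-- The linear character by which the stabilizer of a line acts on it. -/
def lineChar (ρ : Representation ℂ G W) {w : W} (hw : w ≠ 0) : lineStabilizer ρ hw →* ℂˣ :=
  MonoidHom.toHomUnits
    { toFun := lineScalar ρ hw
      map_one' := by
        refine smul_left_injective ℂ hw ?_
        simpa using (lineScalar_spec hw 1).symm
      map_mul' := fun a b => by
        refine smul_left_injective ℂ hw ((lineScalar_spec hw (a * b)).symm.trans ?_)
        rw [Subgroup.coe_mul, map_mul, Module.End.mul_apply, lineScalar_spec hw b, map_smul,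
          lineScalar_spec hw a, smul_smul, mul_comm] }

lemma lineChar_spec {w : W} (hw : w ≠ 0) (b : lineStabilizer ρ hw) :
    ρ b w = (lineChar ρ hw b : ℂ) • w := lineScalar_spec hw b

/-- If a subgroup `B` acts on `w` by a linear character and the translates of `w` by
representatives of the cosets of `B` are linearly independent, then `w` generates a monomial
representation. -/
lemma isMonomial_generated {w : W} {B : Subgroup G} (χ : B →* ℂˣ)
    (hχ : ∀ b : B, ρ b w = (χ b : ℂ) • w)
    (h : LinearIndependent ℂ fun q : Quotient (QuotientGroup.rightRel B) =>
      ρ (q.out)⁻¹ w) : IsMonomial (generated ρ w).toRepresentation := by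
  -- In the induced module the class of `g` stands for translation by `g⁻¹`, whence the right cosets
  -- of `B`.
  let F : G → (generated ρ w).toSubmodule := fun g => ⟨ρ g⁻¹ w, mem_generated w g⁻¹⟩
  have hF : ∀ (b : B) (g : G), (χ b : ℂ) • F (b * g) = F g := by
    intro b g
    apply Subtype.ext
    change (χ b : ℂ) • ρ (b * g : G)⁻¹ w = ρ g⁻¹ w
    have h1 := hχ b
    rw [mul_inv_rev, map_mul, Module.End.mul_apply, ← map_smul, ← map_smul, ← h1]
    simp [← Module.End.mul_apply, ← map_mul]
  let Φ := indLift χ F hF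
  have hΦ : ∀ g a, Φ (Representation.IndV.mk B.subtype (linearRep χ) g a) = a • F g :=
    indLift_mk χ F hF
  have hspan : Submodule.span ℂ (Set.range fun q : Quotient (QuotientGroup.rightRel B) =>
      Representation.IndV.mk B.subtype (linearRep χ) q.out (1 : ℂ)) = ⊤ := by
    refine eq_top_iff.mpr fun u _ => ?_
    have hmk : ∀ (g : G) (a : ℂ), Representation.IndV.mk B.subtype (linearRep χ) g a ∈
        Submodule.span ℂ (Set.range fun q : Quotient (QuotientGroup.rightRel B) =>
          Representation.IndV.mk B.subtype (linearRep χ) q.out (1 : ℂ)) := by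
      intro g a
      let q : Quotient (QuotientGroup.rightRel B) := Quotient.mk _ g
      have hq : g * q.out⁻¹ ∈ B := by
        have := Quotient.mk_out (s := QuotientGroup.rightRel B) g
        exact QuotientGroup.rightRel_apply.mp this
      have h1 := indMk_mul χ ⟨g * q.out⁻¹, hq⟩ q.out a
      rw [show ((⟨g * q.out⁻¹, hq⟩ : B) : G) * q.out = g by simp] at h1
      have h2 := map_smul (Representation.IndV.mk B.subtype (linearRep χ) q.out) a (1 : ℂ)
      rw [smul_eq_mul, mul_one] at h2
      rw [h1, h2, Units.smul_def]
      exact Submodule.smul_mem _ _ (Submodule.smul_mem _ _ (Submodule.subset_span ⟨q, rfl⟩))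
    obtain ⟨t, rfl⟩ := Representation.Coinvariants.mk_surjective _ u
    induction t using TensorProduct.induction_on with
    | zero => simp
    | add a b ha hb => simpa using add_mem (ha trivial) (hb trivial)
    | tmul f a =>
      induction f using MonoidAlgebra.induction_linear with
      | zero => simp
      | add x y hx hy => simpa [TensorProduct.add_tmul] using add_mem (hx trivial) (hy trivial)
      | single g c =>
        have h1 := hmk g (c * a)
        have h2 : (MonoidAlgebra.single g c : MonoidAlgebra ℂ G) ⊗ₜ[ℂ] a
            = MonoidAlgebra.single g 1 ⊗ₜ[ℂ] (c * a) := by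
          rw [← smul_eq_mul, TensorProduct.tmul_smul, TensorProduct.smul_tmul',
            MonoidAlgebra.smul_single, smul_eq_mul, mul_one]
        rw [h2]
        exact h1
  -- The classes of coset representatives span the induced module and have linearly independent
  -- images, so nothing is lost under `Φ`.
  have hinj : Function.Injective Φ := by
    have h1 : LinearIndependent ℂ (Φ ∘ fun q : Quotient (QuotientGroup.rightRel B) =>
        Representation.IndV.mk B.subtype (linearRep χ) q.out (1 : ℂ)) := by
      apply LinearIndependent.of_comp (generated ρ w).toSubmodule.subtype
      convert h using 1
      funext q
      simp only [Function.comp_apply]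
      rw [hΦ, one_smul]
      rfl
    refine Function.Injective.of_comp_right
      (g := Finsupp.linearCombination ℂ fun q : Quotient (QuotientGroup.rightRel B) =>
        Representation.IndV.mk B.subtype (linearRep χ) q.out (1 : ℂ)) ?_ ?_
    · rw [LinearIndependent] at h1
      convert h1 using 1
      funext c
      simp [Finsupp.linearCombination_apply, Finsupp.sum, map_sum]
    · rw [← LinearMap.range_eq_top, Finsupp.range_linearCombination, hspan]
  have hsurj : Function.Surjective Φ := by
    rintro ⟨u, hu⟩
    change u ∈ Submodule.span ℂ _ at hu
    have : u ∈ (LinearMap.range Φ).map (generated ρ w).toSubmodule.subtype := by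
      refine Submodule.span_le.mpr ?_ hu
      rintro _ ⟨g, rfl⟩
      exact ⟨F g⁻¹, ⟨_, (hΦ g⁻¹ 1).trans (one_smul _ _)⟩, by simp [F]⟩
    obtain ⟨v, ⟨t, rfl⟩, hv⟩ := this
    exact ⟨t, Subtype.ext hv⟩
  refine ⟨B, χ, ⟨(Representation.Equiv.mk (LinearEquiv.ofBijective Φ ⟨hinj, hsurj⟩) ?_).symm⟩⟩
  intro g
  apply Representation.IndV.hom_ext
  intro k
  apply LinearMap.ext
  intro a
  change Φ (Representation.ind B.subtype (linearRep χ) g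
      (Representation.IndV.mk B.subtype (linearRep χ) k a))
    = (generated ρ w).toRepresentation g (Φ (Representation.IndV.mk B.subtype (linearRep χ) k a))
  rw [Representation.ind_mk, hΦ, hΦ, map_smul]
  congr 1
  apply Subtype.ext
  change ρ (k * g⁻¹)⁻¹ w = ρ g (ρ k⁻¹ w)
  simp

end Subrep

/-- A family of non-zero vectors `vec p` whose lines are permuted by the group and separated by the
group elements acting diagonally. The lines of a given type form one orbit, that of `head`. -/
structure MonomialSystem {G W : Type*} [Group G] [AddCommGroup W] [Module ℂ W]
    (ρ : Representation ℂ G W) (I P : Type*) where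
  head : I → W
  vec : P → W
  typ : P → I
  transl : P → G
  vec_eq : ∀ p, vec p = ρ (transl p) (head (typ p))
  typ_surjective : Function.Surjective typ
  vec_ne_zero : ∀ p, vec p ≠ 0
  permutes : ∀ g p, ∃ (p' : P) (c : ℂ), typ p' = typ p ∧ ρ g (vec p) = c • vec p'
  separates : ∀ p p', p ≠ p' → ∃ (g : G) (f : P → ℂ),
    (∀ q, ρ g (vec q) = f q • vec q) ∧ f p ≠ f p'

/-! ### Decomposition of the span of a monomial system. -/

namespace MonomialSystem

variable {G W : Type*} [Group G] [AddCommGroup W] [Module ℂ W] {ρ : Representation ℂ G W}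
  {I P : Type*} (Sys : MonomialSystem ρ I P)

/-- A separating `g` lets one subtract `f p'` times the sum from its image: the term at `p'`
disappears, the one at `p` survives, and the result stays in `M`. Repeating this leaves a multiple
of `vec p`. Only invariance of `M` is used, so `M = ⊥` also gives linear independence. -/
lemma vec_mem_of_sum_mem {M : Submodule ℂ W} (hM : ∀ g, ∀ w ∈ M, ρ g w ∈ M) (s : Finset P) :
    ∀ (c : P → ℂ) {p : P}, p ∈ s → c p ≠ 0 → ∑ q ∈ s, c q • Sys.vec q ∈ M → Sys.vec p ∈ M := by
  classical
  induction s using Finset.strongInduction with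
  | H s ih =>
    intro c p hp hc hsum
    by_cases hs : ∃ p' ∈ s, p' ≠ p
    · obtain ⟨p', hp', hne⟩ := hs
      obtain ⟨g, f, hf, hfp⟩ := Sys.separates p p' hne.symm
      refine ih (s.erase p') (Finset.erase_ssubset hp') (fun q => c q * (f q - f p'))
        (Finset.mem_erase.mpr ⟨hne.symm, hp⟩) (mul_ne_zero hc (sub_ne_zero.mpr hfp)) ?_
      have h1 : ρ g (∑ q ∈ s, c q • Sys.vec q) - f p' • ∑ q ∈ s, c q • Sys.vec q
          = ∑ q ∈ s.erase p', (c q * (f q - f p')) • Sys.vec q := by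
        rw [map_sum, Finset.smul_sum, ← Finset.sum_sub_distrib, ← Finset.add_sum_erase _ _ hp']
        rw [map_smul, hf, smul_comm, sub_self, zero_add]
        refine Finset.sum_congr rfl fun q _ => ?_
        rw [map_smul, hf, smul_smul, smul_smul, ← sub_smul]
        congr 1
        ring
      rw [← h1]
      exact M.sub_mem (hM g _ hsum) (M.smul_mem _ hsum)
    · push Not at hs
      have h1 : s = {p} := Finset.eq_singleton_iff_unique_mem.mpr ⟨hp, hs⟩
      rw [h1, Finset.sum_singleton] at hsum
      exact (M.smul_mem_iff hc).mp hsum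

lemma linearIndependent : LinearIndependent ℂ Sys.vec := by
  rw [linearIndependent_iff']
  intro s c hc p hp
  by_contra h0
  have h1 := Sys.vec_mem_of_sum_mem (M := ⊥) (by simp) s c hp h0 (by simp [hc])
  exact Sys.vec_ne_zero p (by simpa using h1)

lemma exists_vec_mem {M : Submodule ℂ W} (hM : ∀ g, ∀ w ∈ M, ρ g w ∈ M) {O : Set P}
    (hO : M ≤ Submodule.span ℂ (Sys.vec '' O)) (h0 : M ≠ ⊥) : ∃ p ∈ O, Sys.vec p ∈ M := by
  obtain ⟨w, hw, hw0⟩ := Submodule.exists_mem_ne_zero_of_ne_bot h0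
  obtain ⟨c, hc, rfl⟩ := (Finsupp.mem_span_image_iff_linearCombination ℂ).mp (hO hw)
  have hc0 : c ≠ 0 := by
    rintro rfl
    simp at hw0
  obtain ⟨p, hp⟩ := Finsupp.support_nonempty_iff.mpr hc0
  exact ⟨p, hc hp, Sys.vec_mem_of_sum_mem hM c.support c hp (Finsupp.mem_support_iff.mp hp) hw⟩

lemma head_mem_iff {M : Submodule ℂ W} (hM : ∀ g, ∀ w ∈ M, ρ g w ∈ M) (p : P) :
    Sys.head (Sys.typ p) ∈ M ↔ Sys.vec p ∈ M := by
  rw [Sys.vec_eq]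
  refine ⟨fun h => hM _ _ h, fun h => ?_⟩
  have h1 := hM (Sys.transl p)⁻¹ _ h
  simpa [← Module.End.mul_apply, ← map_mul] using h1

lemma generated_head (i : I) : (generated ρ (Sys.head i)).toSubmodule
    = Submodule.span ℂ (Sys.vec '' {p | Sys.typ p = i}) := by
  apply le_antisymm
  · refine Submodule.span_le.mpr ?_
    rintro _ ⟨g, rfl⟩
    obtain ⟨p, rfl⟩ := Sys.typ_surjective i
    obtain ⟨p', c, hp', hc⟩ := Sys.permutes (g * (Sys.transl p)⁻¹) p
    have h1 : ρ g (Sys.head (Sys.typ p)) = c • Sys.vec p' := by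
      rw [← hc, Sys.vec_eq]
      simp [← Module.End.mul_apply, ← map_mul]
    change ρ g (Sys.head (Sys.typ p)) ∈ _
    rw [h1]
    exact Submodule.smul_mem _ _ (Submodule.subset_span ⟨p', hp', rfl⟩)
  · refine Submodule.span_le.mpr ?_
    rintro _ ⟨p, rfl, rfl⟩
    rw [Sys.vec_eq]
    exact mem_generated _ _

/-- A non-zero invariant subspace contains some line of the orbit, hence the head, hence everything
the head generates. -/
lemma isIrreducible (i : I) : (generated ρ (Sys.head i)).toRepresentation.IsIrreducible := by
  refine isIrreducible_of_forall_le _ ?_ fun M hM hle h0 => ?_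
  · obtain ⟨p, rfl⟩ := Sys.typ_surjective i
    intro h0
    have h1 : Sys.vec p ∈ (generated ρ (Sys.head (Sys.typ p))).toSubmodule := by
      rw [generated_head]
      exact Submodule.subset_span ⟨p, rfl, rfl⟩
    rw [h0, Submodule.mem_bot] at h1
    exact Sys.vec_ne_zero p h1
  · rw [generated_head] at hle
    obtain ⟨p, rfl, hpM⟩ := Sys.exists_vec_mem hM hle h0
    refine Submodule.span_le.mpr ?_
    rintro _ ⟨g, rfl⟩
    exact hM _ _ ((Sys.head_mem_iff hM p).mpr hpM)

/-- The modules are spanned by disjoint parts of an independent family. The reindexing `j` makes the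
same argument serve `Top` and both eigenspaces of `ι`. -/
lemma isInternalSum {J : Type*} {j : J → I} (hj : Function.Injective j) :
    IsInternalSum (fun a => (generated ρ (Sys.head (j a))).toSubmodule)
      (Submodule.span ℂ (Sys.vec '' {p | Sys.typ p ∈ Set.range j})) := by
  constructor
  · intro a
    have h1 : (⨆ (b : J) (_ : b ≠ a), (generated ρ (Sys.head (j b))).toSubmodule)
        ≤ Submodule.span ℂ (Sys.vec '' {p | Sys.typ p ≠ j a}) := by
      refine iSup₂_le fun b hb => ?_
      rw [generated_head]
      refine Submodule.span_mono (Set.image_mono fun p hp => ?_)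
      intro h2
      exact hb (hj (hp.symm.trans h2))
    refine Disjoint.mono_right h1 ?_
    change Disjoint (generated ρ (Sys.head (j a))).toSubmodule _
    rw [generated_head]
    refine Sys.linearIndependent.disjoint_span_image ?_
    rw [Set.disjoint_left]
    intro p hp hp'
    exact hp' hp
  · simp_rw [generated_head]
    rw [← Submodule.span_iUnion, ← Set.image_iUnion]
    congr 2
    ext p
    simp [eq_comm]

lemma isMonomial (i : I) : IsMonomial (generated ρ (Sys.head i)).toRepresentation := by
  obtain ⟨p, rfl⟩ := Sys.typ_surjective i
  have hw : Sys.head (Sys.typ p) ≠ 0 := by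
    intro h0
    apply Sys.vec_ne_zero p
    rw [Sys.vec_eq, h0, map_zero]
  refine isMonomial_generated (lineChar ρ hw) (lineChar_spec hw) ?_
  have h1 : ∀ g : G, ∃ (p' : P) (c : ℂˣ), ρ g (Sys.head (Sys.typ p)) = c • Sys.vec p' := by
    intro g
    obtain ⟨p', c, -, hc⟩ := Sys.permutes (g * (Sys.transl p)⁻¹) p
    have h1 : ρ g (Sys.head (Sys.typ p)) = c • Sys.vec p' := by
      rw [← hc, Sys.vec_eq]
      simp [← Module.End.mul_apply, ← map_mul]
    have hc0 : c ≠ 0 := by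
      rintro rfl
      have h2 := congrArg (ρ g⁻¹) h1
      simp [← Module.End.mul_apply, ← map_mul, hw] at h2
    exact ⟨p', Units.mk0 c hc0, h1⟩
  choose P' c hc using h1
  -- Two coset representatives leading to the same line differ by an element stabilizing the line of
  -- the head, so cosets and lines of the orbit match.
  have hinj : Function.Injective
      fun q : Quotient (QuotientGroup.rightRel (lineStabilizer ρ hw)) => P' (q.out)⁻¹ := by
    intro q q' hqq
    simp only at hqq
    rw [← Quotient.out_eq q, ← Quotient.out_eq q']
    apply Quotient.sound
    refine QuotientGroup.rightRel_apply.mpr ?_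
    have h2 := hc (q.out)⁻¹
    have h3 := hc (q'.out)⁻¹
    rw [hqq] at h2
    have h4 : Sys.vec (P' (q'.out)⁻¹) = (c (q'.out)⁻¹)⁻¹ • ρ (q'.out)⁻¹ (Sys.head (Sys.typ p)) := by
      rw [h3, inv_smul_smul]
    refine ⟨((c (q.out)⁻¹ * (c (q'.out)⁻¹)⁻¹ : ℂˣ) : ℂ), ?_⟩
    rw [map_mul, Module.End.mul_apply, h2, h4, smul_smul, Units.smul_def, map_smul,
      ← Module.End.mul_apply, ← map_mul, mul_inv_cancel, map_one, Module.End.one_apply]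
  have h2 := (Sys.linearIndependent.comp _ hinj).units_smul
    fun q : Quotient (QuotientGroup.rightRel (lineStabilizer ρ hw)) => c (q.out)⁻¹
  convert h2 using 1
  funext q
  rw [hc]
  rfl

/-- The restriction of a monomial system to a subrepresentation containing its vectors. -/
def restrict (τ : Subrepresentation ρ) (h : ∀ p, Sys.vec p ∈ τ.toSubmodule) :
    MonomialSystem τ.toRepresentation I P where
  head i := ⟨Sys.head i, by
    obtain ⟨p, rfl⟩ := Sys.typ_surjective i
    exact (Sys.head_mem_iff (fun g w hw => τ.apply_mem_toSubmodule g hw) p).mpr (h p)⟩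
  vec p := ⟨Sys.vec p, h p⟩
  typ := Sys.typ
  transl := Sys.transl
  vec_eq p := Subtype.ext (Sys.vec_eq p)
  typ_surjective := Sys.typ_surjective
  vec_ne_zero p h0 := Sys.vec_ne_zero p (congrArg Subtype.val h0)
  permutes g p := by
    obtain ⟨p', c, hp', hc⟩ := Sys.permutes g p
    exact ⟨p', c, hp', Subtype.ext hc⟩
  separates p p' hne := by
    obtain ⟨g, f, hf, hfp⟩ := Sys.separates p p' hne
    exact ⟨g, f, fun q => Subtype.ext (hf q), hfp⟩

/-- Take `vec p` in `W₁`. Its image in `W₂` has the same eigenvalues under the diagonal elements,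
and these single out the line of `vec p`. So `W₂` contains `vec p` too, and irreducible
subrepresentations sharing a non-zero vector coincide. -/
lemma isMultiplicityFree_of_span_eq_top (hspan : Submodule.span ℂ (Set.range Sys.vec) = ⊤) :
    IsMultiplicityFree ρ := by
  rintro W₁ W₂ h₁ h₂ ⟨e⟩
  have hM₁ : ∀ g, ∀ w ∈ W₁.toSubmodule, ρ g w ∈ W₁.toSubmodule :=
    fun g w hw => W₁.apply_mem_toSubmodule g hw
  have h10 : W₁.toSubmodule ≠ ⊥ := by
    intro h0
    have : (⊥ : Subrepresentation W₁.toRepresentation) = ⊤ := by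
      apply Subrepresentation.toSubmodule_injective
      change (⊥ : Submodule ℂ W₁.toSubmodule) = ⊤
      refine (eq_bot_iff.mpr fun w _ => ?_).symm
      exact Subtype.ext ((Submodule.eq_bot_iff _).mp h0 w w.2)
    exact bot_ne_top this
  obtain ⟨p, -, hp⟩ := Sys.exists_vec_mem (O := Set.univ) hM₁
    (by rw [Set.image_univ, hspan]; exact le_top) h10
  set u := e ⟨Sys.vec p, hp⟩ with hu
  have hu0 : (u : W) ≠ 0 := by
    intro h0
    have h1 : u = 0 := Subtype.ext h0
    have h2 : (⟨Sys.vec p, hp⟩ : W₁.toSubmodule) = 0 := by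
      apply e.toLinearEquiv.injective
      rw [map_zero]
      exact h1
    exact Sys.vec_ne_zero p (congrArg Subtype.val h2)
  have heig : ∀ (g : G) (a : ℂ), ρ g (Sys.vec p) = a • Sys.vec p → ρ g (u : W) = a • (u : W) := by
    intro g a hga
    have h1 : e (W₁.toRepresentation g ⟨Sys.vec p, hp⟩) = W₂.toRepresentation g u :=
      Representation.IntertwiningMap.isIntertwining _ _ e.toIntertwiningMap g _
    have h2 : W₁.toRepresentation g ⟨Sys.vec p, hp⟩ = a • ⟨Sys.vec p, hp⟩ := Subtype.ext hga
    rw [h2, map_smul] at h1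
    exact (congrArg Subtype.val h1).symm
  have hup : Sys.vec p ∈ W₂.toSubmodule := by
    have huspan : (u : W) ∈ Submodule.span ℂ (Set.range Sys.vec) := hspan ▸ trivial
    obtain ⟨c, hc⟩ := Finsupp.mem_span_range_iff_exists_finsupp.mp huspan
    -- An element separating `p` from `q` acts on `u` by `f p` and on the component at `q` by `f q ≠
    -- f p`.
    have hcq : ∀ q, q ≠ p → c q = 0 := by
      intro q hq
      obtain ⟨g, f, hf, hfq⟩ := Sys.separates p q hq.symm
      have h1 := heig g (f p) (hf p)
      rw [← hc, Finsupp.sum, map_sum, Finset.smul_sum, ← sub_eq_zero,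
        ← Finset.sum_sub_distrib] at h1
      by_contra hcq
      have h2 := linearIndependent_iff'.mp Sys.linearIndependent c.support
        (fun q => c q * (f q - f p)) (by
          rw [← h1]
          refine Finset.sum_congr rfl fun r _ => ?_
          rw [map_smul, hf, smul_smul, smul_smul, ← sub_smul]
          congr 1
          ring) q (Finsupp.mem_support_iff.mpr hcq)
      rcases mul_eq_zero.mp h2 with h3 | h3
      · exact hcq h3
      · exact hfq (sub_eq_zero.mp h3).symm
    have hcp : (u : W) = c p • Sys.vec p := by
      rw [← hc]
      exact Finsupp.sum_eq_single p (fun q _ hq => by rw [hcq q hq, zero_smul]) (by simp)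
    have hcp0 : c p ≠ 0 := by
      intro h0
      rw [h0, zero_smul] at hcp
      exact hu0 hcp
    refine (W₂.toSubmodule.smul_mem_iff hcp0).mp ?_
    rw [← hcp]
    exact u.2
  exact Subrepresentation.toSubmodule_injective (le_antisymm
    (le_of_isIrreducible _ _ h₁ hp hup (Sys.vec_ne_zero p))
    (le_of_isIrreducible _ _ h₂ hup hp (Sys.vec_ne_zero p)))

lemma isMultiplicityFree (τ : Subrepresentation ρ)
    (h : τ.toSubmodule = Submodule.span ℂ (Set.range Sys.vec)) :
    IsMultiplicityFree τ.toRepresentation := by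
  have hmem : ∀ p, Sys.vec p ∈ τ.toSubmodule := fun p => h ▸ Submodule.subset_span ⟨p, rfl⟩
  refine (Sys.restrict τ hmem).isMultiplicityFree_of_span_eq_top ?_
  apply Submodule.map_injective_of_injective τ.toSubmodule.injective_subtype
  rw [Submodule.map_span, Submodule.map_subtype_top, ← Set.range_comp]
  exact h.symm

lemma span_inf_eigenspace {g : G} {f : P → ℂ} (hf : ∀ p, ρ g (Sys.vec p) = f p • Sys.vec p) (a : ℂ) :
    Submodule.span ℂ (Set.range Sys.vec) ⊓ Module.End.eigenspace (ρ g) a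
      = Submodule.span ℂ (Sys.vec '' {p | f p = a}) := by
  apply le_antisymm
  · rintro w ⟨hw, hwa⟩
    obtain ⟨c, rfl⟩ := Finsupp.mem_span_range_iff_exists_finsupp.mp hw
    rw [SetLike.mem_coe, Module.End.mem_eigenspace_iff, Finsupp.sum, map_sum, Finset.smul_sum,
      ← sub_eq_zero, ← Finset.sum_sub_distrib] at hwa
    refine Submodule.sum_mem _ fun p hp => Submodule.smul_mem _ _ (Submodule.subset_span ⟨p, ?_, rfl⟩)
    have h2 := linearIndependent_iff'.mp Sys.linearIndependent c.support
      (fun q => c q * (f q - a)) (by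
        rw [← hwa]
        refine Finset.sum_congr rfl fun r _ => ?_
        rw [map_smul, hf, smul_smul, smul_smul, ← sub_smul]
        congr 1
        ring) p hp
    exact sub_eq_zero.mp ((mul_eq_zero.mp h2).resolve_left (Finsupp.mem_support_iff.mp hp))
  · refine Submodule.span_le.mpr ?_
    rintro _ ⟨p, rfl, rfl⟩
    exact ⟨Submodule.subset_span ⟨p, rfl⟩, Module.End.mem_eigenspace_iff.mpr (hf p)⟩

lemma finrank_span_image [Finite P] (O : Set P) :
    Module.finrank ℂ (Submodule.span ℂ (Sys.vec '' O)) = O.ncard := by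
  classical
  have := Fintype.ofFinite P
  have h1 := finrank_span_set_eq_card (R := ℂ) (s := Sys.vec '' O)
    (Sys.linearIndependent.linearIndepOn_id.mono (Set.image_subset_range _ _))
  rw [h1, ← Set.ncard_eq_toFinset_card', Set.ncard_image_of_injective _ Sys.linearIndependent.injective]

end MonomialSystem

/-- Used with `F` the action of `g` and `F'` that of a scalar, to pass from `e_v` to the sum
`E_{φ,v}`. -/
lemma map_sum_smul_eq_smul_map {ι W : Type*} [Fintype ι] [AddCommGroup W] [Module ℂ W]
    {F F' : W →ₗ[ℂ] W} {c : ℂ} {u : ι → W} (a : ι → ℂ) (h : ∀ i, F (u i) = c • F' (u i)) :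
    F (∑ i, a i • u i) = c • F' (∑ i, a i • u i) := by
  rw [map_sum, map_sum, Finset.smul_sum]
  refine Finset.sum_congr rfl fun i _ => ?_
  rw [map_smul, h, map_smul, smul_smul, smul_smul, mul_comm]

open QuadraticAlgebra

namespace WeilData

variable {R : Type*} [CommRing R] [IsLocalRing R] {x : R}
  {V : Type*} [AddCommGroup V] [Module (RamExt R x) V] (D : WeilData R x V)

/-! ### The rings `R` and `A` -/

include D in
lemma x_mem : x ∈ IsLocalRing.maximalIdeal R := by
  rw [D.gen]
  exact Ideal.mem_span_singleton_self x

lemma x_pow_eq_zero_iff (k : ℕ) : x ^ k = 0 ↔ D.ell ≤ k := by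
  have h1 : ∀ k, IsLocalRing.maximalIdeal R ^ k = ⊥ ↔ x ^ k = 0 := by
    intro k
    rw [D.gen, Ideal.span_singleton_pow, Ideal.span_singleton_eq_bot]
  constructor
  · intro h
    exact D.nilpotency.2 ((h1 k).mpr h)
  · intro h
    exact pow_eq_zero_of_le h ((h1 _).mp D.nilpotency.1)

lemma ell_pos : 1 ≤ D.ell := by
  by_contra h
  have := (D.x_pow_eq_zero_iff 0).mpr (by omega)
  simp at this

include D in
-- A non-unit is divisible by `x`; dividing repeatedly stops at a unit or reaches `x ^ ell = 0`.
lemma exists_eq_unit_mul_x_pow (r : R) : ∃ (u : R) (k : ℕ), IsUnit u ∧ r = u * x ^ k := by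
  have h1 : ∀ n, (∃ (u : R) (k : ℕ), IsUnit u ∧ r = u * x ^ k) ∨ ∃ s, r = s * x ^ n := by
    intro n
    induction n with
    | zero => exact Or.inr ⟨r, by simp⟩
    | succ n ih =>
      rcases ih with h | ⟨s, hs⟩
      · exact Or.inl h
      · by_cases hu : IsUnit s
        · exact Or.inl ⟨s, n, hu, hs⟩
        · right
          have h2 : s ∈ IsLocalRing.maximalIdeal R := hu
          rw [D.gen, Ideal.mem_span_singleton'] at h2
          obtain ⟨t, rfl⟩ := h2
          exact ⟨t, by rw [hs]; ring⟩
  rcases h1 D.ell with h | ⟨s, hs⟩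
  · exact h
  · have h0 := (D.x_pow_eq_zero_iff D.ell).mpr le_rfl
    -- Here `r = 0`, which is given the factorization with unit `1` and exponent `ell`.
    exact ⟨1, D.ell, isUnit_one, by rw [hs, h0]; simp⟩

include D in
-- The norm `re² - x im²` is congruent to `re²` modulo the maximal ideal.
lemma isUnit_of_isUnit_re {a : RamExt R x} (h : IsUnit a.re) : IsUnit a := by
  rw [isUnit_iff_norm_isUnit, norm_def]
  by_contra h1
  have h2 : a.re * a.re + 0 * a.re * a.im - x * a.im * a.im ∈ IsLocalRing.maximalIdeal R := h1
  have h3 := Ideal.add_mem _ h2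
    (Ideal.mul_mem_right a.im _ (Ideal.mul_mem_right a.im _ D.x_mem))
  have h4 : a.re * a.re ∈ IsLocalRing.maximalIdeal R := by
    convert h3 using 1
    ring
  exact h4 (h.mul h)

omit [IsLocalRing R] in
lemma omega_mul_omega : (omega : RamExt R x) * omega = algebraMap R (RamExt R x) x := by
  ext <;> simp

omit [IsLocalRing R] in
lemma omega_pow_two_mul (k : ℕ) :
    (omega : RamExt R x) ^ (2 * k) = ⟨x ^ k, 0⟩ := by
  rw [pow_mul, pow_two, omega_mul_omega, ← map_pow]
  rfl

omit [IsLocalRing R] in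
lemma star_omega : star (omega : RamExt R x) = -omega := by
  ext <;> simp

lemma omega_pow_eq_zero_iff (n : ℕ) : (omega : RamExt R x) ^ n = 0 ↔ 2 * D.ell ≤ n := by
  constructor
  · intro h
    by_contra hn
    -- The exponent `2ℓ - 1` is the last with non-zero power: its imaginary part is `x ^ (ℓ - 1)`.
    have h1 : (omega : RamExt R x) ^ (2 * (D.ell - 1) + 1) = 0 :=
      pow_eq_zero_of_le (by have := D.ell_pos; omega) h
    rw [pow_succ, omega_pow_two_mul] at h1
    have h2 := congrArg QuadraticAlgebra.im h1
    have h3 : x ^ (D.ell - 1) = 0 := by simpa using h2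
    rw [D.x_pow_eq_zero_iff] at h3
    have := D.ell_pos
    omega
  · intro h
    refine pow_eq_zero_of_le h ?_
    rw [omega_pow_two_mul, (D.x_pow_eq_zero_iff _).mpr le_rfl]
    rfl

include D in
-- The real part contributes even and the imaginary part odd exponents of `y`, so the smaller of the
-- two decides; equal `x`-exponents favour the real part.
lemma exists_eq_unit_mul_omega_pow (a : RamExt R x) :
    ∃ (u : RamExt R x) (n : ℕ), IsUnit u ∧ a = u * omega ^ n := by
  obtain ⟨u, j, hu, hj⟩ := D.exists_eq_unit_mul_x_pow a.re
  obtain ⟨w, k, hw, hk⟩ := D.exists_eq_unit_mul_x_pow a.im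
  by_cases hjk : j ≤ k
  · obtain ⟨i, rfl⟩ := Nat.exists_eq_add_of_le hjk
    refine ⟨⟨u, w * x ^ i⟩, 2 * j, D.isUnit_of_isUnit_re hu, ?_⟩
    rw [omega_pow_two_mul]
    ext
    · simp [hj]
    · simp [hk, pow_add]; ring
  · obtain ⟨i, rfl⟩ := Nat.exists_eq_add_of_lt (not_le.mp hjk)
    refine ⟨⟨w, u * x ^ i⟩, 2 * k + 1, D.isUnit_of_isUnit_re hw, ?_⟩
    rw [pow_succ, omega_pow_two_mul]
    ext
    · simp [hj, pow_add]; ring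
    · simp [hk]

lemma mem_idealI {a : RamExt R x} : a ∈ D.idealI ↔ ∃ b, b * omega ^ D.ell = a := by
  rw [idealI, rad, Ideal.span_singleton_pow, Ideal.mem_span_singleton']

/-- The ideal `𝔦` is its own annihilator, because `y` has nilpotency degree exactly `2ℓ`. -/
lemma mem_idealI_iff_mul_omega_pow {a : RamExt R x} :
    a ∈ D.idealI ↔ a * omega ^ D.ell = 0 := by
  rw [mem_idealI]
  constructor
  · rintro ⟨b, rfl⟩
    rw [mul_assoc, ← pow_add, (D.omega_pow_eq_zero_iff _).mpr (by omega), mul_zero]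
  · intro h
    obtain ⟨u, n, hu, rfl⟩ := D.exists_eq_unit_mul_omega_pow a
    rw [mul_assoc, ← pow_add, hu.mul_right_eq_zero, D.omega_pow_eq_zero_iff] at h
    obtain ⟨k, rfl⟩ : ∃ k, n = k + D.ell := ⟨n - D.ell, by omega⟩
    exact ⟨u * omega ^ k, by ring⟩

lemma isUnit_of_notMem_rad {a : RamExt R x} (h : a ∉ D.rad) : IsUnit a := by
  obtain ⟨u, n, hu, rfl⟩ := D.exists_eq_unit_mul_omega_pow a
  cases n with
  | zero => simpa using hu
  | succ n =>
    exfalso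
    refine h (Ideal.mem_span_singleton'.mpr ⟨u * omega ^ n, by ring⟩)

lemma mem_rad_iff {a : RamExt R x} : a ∈ D.rad ↔ a.re ∈ IsLocalRing.maximalIdeal R := by
  rw [rad, D.gen, Ideal.mem_span_singleton', Ideal.mem_span_singleton']
  constructor
  · rintro ⟨b, rfl⟩
    exact ⟨b.im, by simp [mul_comm]⟩
  · rintro ⟨r, hr⟩
    refine ⟨⟨a.im, r⟩, ?_⟩
    ext
    · simp [← hr, mul_comm]
    · simp

lemma idealI_le_rad : D.idealI ≤ D.rad :=
  Ideal.pow_le_self (by have := D.ell_pos; omega)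

lemma mul_eq_zero_of_mem_idealI {a b : RamExt R x} (ha : a ∈ D.idealI) (hb : b ∈ D.idealI) :
    a * b = 0 := by
  have h1 := Ideal.mul_mem_mul ha hb
  rw [idealI_mul_self] at h1
  simpa using h1

lemma star_mem_idealI_iff {a : RamExt R x} : star a ∈ D.idealI ↔ a ∈ D.idealI :=
  ⟨fun h => by simpa using D.star_mem_idealI _ h, D.star_mem_idealI a⟩

lemma mu_apply (a : RamExt R x) : D.mu a = D.lam (2 * a.im) := rfl

/-- Multipliers in `Ry` test the real part of `a` and multipliers in `R` its imaginary part; the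
factor `2` is harmless since it is a unit. -/
lemma mu_primitive (h2 : IsUnit (2 : R)) {a : RamExt R x} (h : ∀ b, D.mu (a * b) = 1) : a = 0 := by
  have key : ∀ r : R, (∀ s, D.lam (r * s) = 1) → r = 0 := by
    intro r hr
    by_contra h0
    refine D.primitive h0 ?_
    ext s
    simpa [AddChar.mulShift_apply] using hr s
  have key2 : ∀ r : R, (∀ s, D.lam (2 * (r * s)) = 1) → r = 0 := by
    intro r hr
    rw [← h2.mul_right_eq_zero]
    exact key _ fun s => by rw [mul_assoc]; exact hr s
  ext
  · refine key2 _ fun s => ?_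
    have h1 := h ⟨0, s⟩
    simpa [mu_apply] using h1
  · refine key2 _ fun s => ?_
    have h1 := h ⟨s, 0⟩
    simpa [mu_apply] using h1

/-! ### Cardinalities -/

include D in
-- Below the nilpotency degree, multiplication by `x ^ k` identifies the residue field with the
-- layer `(x ^ k) / (x ^ (k + 1))`.
lemma card_quotient_x_pow [Finite R] (k : ℕ) (hk : k ≤ D.ell) :
    Nat.card (R ⧸ Ideal.span {x ^ k}) = Nat.card (IsLocalRing.ResidueField R) ^ k := by
  induction k with
  | zero =>
    have : Subsingleton (R ⧸ Ideal.span {x ^ 0}) := by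
      rw [Ideal.Quotient.subsingleton_iff]
      simp
    simp
  | succ k ih =>
    have hle : Ideal.span {x ^ (k + 1)} ≤ Ideal.span {x ^ k} := by
      rw [Ideal.span_singleton_le_span_singleton]
      exact pow_dvd_pow x (Nat.le_succ k)
    have h1 := Submodule.card_quotient_mul_card_quotient (Ideal.span {x ^ k})
      (Ideal.span {x ^ (k + 1)}) hle
    let f : R →ₗ[R] R ⧸ Ideal.span {x ^ (k + 1)} :=
      (Submodule.mkQ (Ideal.span {x ^ (k + 1)})).comp (LinearMap.toSpanSingleton R R (x ^ k))
    have hker : LinearMap.ker f = IsLocalRing.maximalIdeal R := by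
      ext r
      have h2 : r ∈ LinearMap.ker f ↔ r * x ^ k ∈ Ideal.span {x ^ (k + 1)} := by
        rw [LinearMap.mem_ker, ← Submodule.Quotient.mk_eq_zero]
        rfl
      rw [h2, Ideal.mem_span_singleton']
      constructor
      · rintro ⟨s, hs⟩
        intro hu
        have h3 : IsUnit (r - s * x) := by
          by_contra hn
          have h4 : r - s * x ∈ IsLocalRing.maximalIdeal R := hn
          have h5 := Ideal.add_mem _ h4 (Ideal.mul_mem_left _ s D.x_mem)
          rw [sub_add_cancel] at h5
          exact h5 hu
        have h4 : (r - s * x) * x ^ k = 0 := by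
          rw [sub_mul, ← hs]
          ring
        rw [h3.mul_right_eq_zero, D.x_pow_eq_zero_iff] at h4
        omega
      · intro hr
        rw [D.gen, Ideal.mem_span_singleton'] at hr
        obtain ⟨s, rfl⟩ := hr
        exact ⟨s, by ring⟩
    have hrange : LinearMap.range f
        = Submodule.map (Submodule.mkQ (Ideal.span {x ^ (k + 1)})) (Ideal.span {x ^ k}) := by
      rw [LinearMap.range_comp, LinearMap.range_toSpanSingleton]
    have h2 : Nat.card (LinearMap.range f) = Nat.card (IsLocalRing.ResidueField R) := by
      rw [← Nat.card_congr f.quotKerEquivRange.toEquiv, hker]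
      rfl
    rw [← h1, ih (by omega), ← hrange, h2, pow_succ, mul_comm]

include D in
lemma card_eq_card_residueField_pow [Finite R] :
    Nat.card R = Nat.card (IsLocalRing.ResidueField R) ^ D.ell := by
  rw [← D.card_quotient_x_pow D.ell le_rfl, (D.x_pow_eq_zero_iff _).mpr le_rfl]
  have : Ideal.span {(0 : R)} = ⊥ := by simp
  rw [this]
  exact Nat.card_congr (Submodule.quotEquivOfEqBot _ rfl).symm.toEquiv

omit [IsLocalRing R] in
lemma card_ramExt : Nat.card (RamExt R x) = Nat.card R * Nat.card R := by
  rw [Nat.card_congr (equivProd x 0), Nat.card_prod]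

omit [IsLocalRing R] in
instance finite_ramExt [Finite R] : Finite (RamExt R x) :=
  Finite.of_equiv _ (equivProd x 0).symm

/-- Multiplication by `y ^ ℓ` on `A` has kernel and range both equal to `𝔦`, so `|𝔦|² = |A| = |R|²`.
-/
lemma card_idealI [Finite R] : Nat.card D.idealI = Nat.card R := by
  let f : RamExt R x →ₗ[RamExt R x] RamExt R x :=
    LinearMap.toSpanSingleton (RamExt R x) (RamExt R x) (omega ^ D.ell)
  have hker : LinearMap.ker f = D.idealI := by
    ext a
    rw [mem_idealI_iff_mul_omega_pow]
    simp [f, LinearMap.mem_ker]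
  have hrange : LinearMap.range f = D.idealI := by
    rw [LinearMap.range_toSpanSingleton, idealI, rad, Ideal.span_singleton_pow]
  have h1 := Submodule.card_eq_card_quotient_mul_card (LinearMap.ker f)
  rw [Nat.card_congr f.quotKerEquivRange.toEquiv, hrange, hker, card_ramExt] at h1
  nlinarith [Nat.zero_le (Nat.card R), Nat.zero_le (Nat.card D.idealI)]

lemma card_rad [Finite R] :
    Nat.card D.rad * Nat.card (IsLocalRing.ResidueField R) = Nat.card R * Nat.card R := by
  let f : RamExt R x →ₗ[R] R ⧸ IsLocalRing.maximalIdeal R :=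
    (Submodule.mkQ (IsLocalRing.maximalIdeal R)).comp (reₗ x 0)
  have hsurj : Function.Surjective f :=
    (Submodule.mkQ_surjective _).comp fun r => ⟨⟨r, 0⟩, rfl⟩
  have h1 := Submodule.card_eq_card_quotient_mul_card (LinearMap.ker f)
  rw [Nat.card_congr (f.quotKerEquivOfSurjective hsurj).toEquiv, card_ramExt] at h1
  rw [h1]
  refine congrArg (· * Nat.card (R ⧸ IsLocalRing.maximalIdeal R)) ?_
  refine Nat.card_congr (Equiv.subtypeEquivRight fun a => ?_)
  rw [mem_rad_iff, LinearMap.mem_ker]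
  exact (Submodule.Quotient.mk_eq_zero _).symm

/-! ### The hermitian form -/

lemma mem_V0_iff {v : V} : v ∈ D.V0 ↔ ∃ w : V, (omega : RamExt R x) ^ D.ell • w = v := by
  rw [V0, idealI, rad, Ideal.span_singleton_pow, Submodule.ideal_span_singleton_smul,
    Submodule.mem_smul_pointwise_iff_exists]
  simp

lemma mem_rad_smul_top_iff {v : V} : v ∈ (D.rad • ⊤ : Submodule (RamExt R x) V) ↔
    ∃ w : V, (omega : RamExt R x) • w = v := by
  rw [rad, Submodule.ideal_span_singleton_smul, Submodule.mem_smul_pointwise_iff_exists]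
  simp

lemma V0_le_rad_smul_top : D.V0 ≤ (D.rad • ⊤ : Submodule (RamExt R x) V) :=
  Submodule.smul_mono_left D.idealI_le_rad

lemma h_smul_left (a : RamExt R x) (u v : V) : D.h (a • u) v = star a * D.h u v := by
  rw [map_smulₛₗ, LinearMap.smul_apply, smul_eq_mul, starRingEnd_apply]

lemma h_smul_right (a : RamExt R x) (u v : V) : D.h u (a • v) = a * D.h u v := by
  simp

lemma h_left_mem_idealI {u : V} (hu : u ∈ D.V0) (w : V) : D.h u w ∈ D.idealI :=
  D.h_left_mem D.star_mem_idealI hu w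

/-- Divide the values of `h v` on a basis by `y ^ n`; non-degeneracy represents the resulting
functional by a vector. -/
lemma exists_eq_omega_pow_smul [Module.Free (RamExt R x) V] [Module.Finite (RamExt R x) V]
    (n : ℕ) {v : V} (hv : ∀ p, ∃ a, a * omega ^ n = D.h v p) :
    ∃ w : V, (omega : RamExt R x) ^ n • w = v := by
  let b := Module.Free.chooseBasis (RamExt R x) V
  choose a ha using hv
  obtain ⟨w, hw⟩ := D.nondegenerate.2 (b.constr (RamExt R x) fun j => a (b j))
  -- The sign compensates `y* = -y`, since `h` is semilinear in the first variable.
  refine ⟨((-1) ^ n : RamExt R x) • w, ?_⟩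
  apply D.nondegenerate.1
  refine b.ext fun j => ?_
  have h1 : D.h w (b j) = a (b j) := by
    have h2 := LinearMap.congr_fun hw (b j)
    simpa using h2
  rw [smul_smul, h_smul_left, h1, star_mul, star_pow, star_pow, star_neg, star_one, star_omega,
    ← mul_pow, ← ha, mul_comm]
  congr 2
  ring

lemma mem_V0_of_forall [Module.Free (RamExt R x) V] [Module.Finite (RamExt R x) V]
    {v : V} (hv : ∀ p, D.h p v ∈ D.idealI) : v ∈ D.V0 := by
  rw [mem_V0_iff]
  refine D.exists_eq_omega_pow_smul D.ell fun p => ?_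
  rw [← mem_idealI, D.hermitian p v, star_mem_idealI_iff]
  exact hv p

/-- If no value of `h v` were a unit, all would be divisible by `y`, and then so would `v`. -/
lemma exists_h_eq_one [Module.Free (RamExt R x) V] [Module.Finite (RamExt R x) V]
    {v : V} (hv : D.IsPrimitiveVec v) : ∃ p, D.h v p = 1 := by
  by_contra! h
  apply hv
  rw [mem_rad_smul_top_iff]
  have h1 : ∃ w : V, (omega : RamExt R x) ^ 1 • w = v := by
    refine D.exists_eq_omega_pow_smul 1 fun p => ?_
    by_contra hp
    have h2 : IsUnit (D.h v p) := by
      apply D.isUnit_of_notMem_rad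
      rwa [rad, Ideal.mem_span_singleton', ← pow_one omega]
    obtain ⟨c, hc⟩ := h2.exists_left_inv
    exact h (c • p) (by rw [h_smul_right, hc])
  simpa using h1

lemma mu_star (a : RamExt R x) : D.mu (star a) = D.mu (-a) := by
  simp [mu_apply]

/-- This makes cross terms `h(v,u) + h(u,v)` invisible to `μ`. -/
lemma mu_add_star (a : RamExt R x) : D.mu (a + star a) = 1 := by
  simp [mu_apply]

lemma mu_h_self (v : V) : D.mu (D.h v v) = 1 := by
  have h1 := congrArg QuadraticAlgebra.im (D.hermitian v v)
  have h3 : 2 * (D.h v v).im = 0 := by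
    simp at h1
    linear_combination h1
  rw [mu_apply, h3, AddChar.map_zero_eq_one]

lemma isPrimitiveVec_of_sub_mem {v w : V} (h : v - w ∈ D.V0) (hv : D.IsPrimitiveVec v) :
    D.IsPrimitiveVec w := by
  intro hw
  apply hv
  have := add_mem (D.V0_le_rad_smul_top h) hw
  rwa [sub_add_cancel] at this

lemma isPrimitiveVec_map (g : V ≃ₗ[RamExt R x] V) {v : V} (hv : D.IsPrimitiveVec v) :
    D.IsPrimitiveVec (g v) := by
  intro hg
  apply hv
  rw [mem_rad_smul_top_iff] at hg ⊢
  obtain ⟨w, hw⟩ := hg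
  exact ⟨g.symm w, by rw [← map_smul, hw, LinearEquiv.symm_apply_apply]⟩

/-- One Newton step suffices: with `t = aa* - 1`, the element `a(1 - t/2)` has norm one because `t²
= 0`. -/
lemma exists_normOne_of_mul_star_sub_one_mem (h2 : IsUnit (2 : R)) {a : RamExt R x}
    (ha : a * star a - 1 ∈ D.idealI) : ∃ z : D.NormOne, (z : RamExt R x) - a ∈ D.idealI := by
  obtain ⟨r, hr⟩ := h2.exists_left_inv
  let c : RamExt R x := ⟨r, 0⟩
  have hc : c * 2 = 1 := by
    ext
    · simp [c, hr]
    · simp [c]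
  have hcs : star c = c := by ext <;> simp [c]
  set t := a * star a - 1 with ht
  have hts : star t = t := by simp [ht, mul_comm]
  have htt : t * t = 0 := D.mul_eq_zero_of_mem_idealI ha ha
  have hz : (a * (1 - c * t)) * star (a * (1 - c * t)) = 1 := by
    have h1 : star (a * (1 - c * t)) = star a * (1 - c * t) := by
      rw [star_mul, star_sub, star_one, star_mul, hts, hcs]
      ring
    have h3 : a * star a = 1 + t := by rw [ht]; ring
    rw [h1]
    linear_combination (1 - c * t) ^ 2 * h3 + (c ^ 2 * (1 + t) - c * 2) * htt - t * hc
  refine ⟨⟨a * (1 - c * t), Unitary.mem_iff_self_mul_star.mpr hz⟩, ?_⟩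
  have h4 : a * (1 - c * t) - a = -(a * c) * t := by ring
  rw [h4]
  exact D.idealI.mul_mem_left _ ha

lemma scalar_apply (z : D.NormOne) (v : V) : (D.scalar z).1 v = (z : RamExt R x) • v := rfl

lemma mem_idealI_of_smul_mem_V0 [Module.Free (RamExt R x) V] [Module.Finite (RamExt R x) V]
    {v : V} (hv : D.IsPrimitiveVec v) {a : RamExt R x} (ha : a • v ∈ D.V0) : a ∈ D.idealI := by
  obtain ⟨p, hp⟩ := D.exists_h_eq_one hv
  have h1 := D.h_left_mem_idealI ha p
  rwa [h_smul_left, hp, mul_one, star_mem_idealI_iff] at h1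

lemma smul_mem_V0_of_mem_idealI {a : RamExt R x} (ha : a ∈ D.idealI) (v : V) : a • v ∈ D.V0 :=
  Submodule.smul_mem_smul ha trivial

/-- Hence `C(v) ∩ N` is the same group for every primitive `v`, which is why one group `G` serves
all of `S`. -/
lemma scalar_mem_stab_iff [Module.Free (RamExt R x) V] [Module.Finite (RamExt R x) V]
    {v : V} (hv : D.IsPrimitiveVec v) (z : D.NormOne) :
    D.scalar z ∈ D.stab v ↔ (z : RamExt R x) - 1 ∈ D.idealI := by
  have h1 : D.scalar z ∈ D.stab v ↔ ((z : RamExt R x) - 1) • v ∈ D.V0 := by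
    rw [sub_smul, one_smul]
    rfl
  rw [h1]
  exact ⟨D.mem_idealI_of_smul_mem_V0 hv, fun h => D.smul_mem_V0_of_mem_idealI h v⟩

/-! ### The congruence subgroup -/

/-- Linearity turns the factor `y ^ ℓ` of `u` and that of the values of `k` into `y ^ (2ℓ) = 0`. In
particular `k² = 0`, so `1 + k` has inverse `1 - k`. -/
lemma map_V0_eq_zero {k : V →ₗ[RamExt R x] V} (hk : ∀ v, k v ∈ D.V0) {u : V} (hu : u ∈ D.V0) :
    k u = 0 := by
  obtain ⟨w, rfl⟩ := D.mem_V0_iff.mp hu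
  obtain ⟨w', hw'⟩ := D.mem_V0_iff.mp (hk w)
  rw [map_smul, ← hw', smul_smul, ← pow_add, (D.omega_pow_eq_zero_iff _).mpr (by omega), zero_smul]

/-- The unitary transformation `1 + k`, for `k` skew-hermitian with values in `V₀`. -/
def congruenceElt (k : V →ₗ[RamExt R x] V) (hk : ∀ v, k v ∈ D.V0)
    (hs : ∀ u v, D.h (k u) v + D.h u (k v) = 0) : D.unitaryGroup :=
  ⟨LinearEquiv.ofLinearMap (LinearMap.id + k) (LinearMap.id - k)
    (by ext v; simp [D.map_V0_eq_zero hk (hk v)])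
    (by ext v; simp [D.map_V0_eq_zero hk (hk v)]), by
    intro u v
    simp only [LinearEquiv.coe_ofLinearMap, LinearMap.add_apply, LinearMap.id_apply, map_add]
    rw [D.h_V0_V0 (hk u) (hk v)]
    linear_combination hs u v⟩

lemma congruenceElt_apply (k : V →ₗ[RamExt R x] V) (hk : ∀ v, k v ∈ D.V0)
    (hs : ∀ u v, D.h (k u) v + D.h u (k v) = 0) (v : V) :
    (D.congruenceElt k hk hs).1 v = v + k v := rfl

/-- The skew-hermitian transformation `u ↦ c h(q, u) p - c* h(p, u) q`. -/
def skew (c : RamExt R x) (p q : V) : V →ₗ[RamExt R x] V :=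
  (D.h q).smulRight (c • p) - (D.h p).smulRight (star c • q)

lemma skew_apply (c : RamExt R x) (p q u : V) :
    D.skew c p q u = D.h q u • c • p - D.h p u • star c • q := rfl

lemma skew_mem_V0 {c : RamExt R x} (hc : c ∈ D.idealI) (p q u : V) : D.skew c p q u ∈ D.V0 := by
  rw [skew_apply]
  exact sub_mem (D.V0.smul_mem _ (D.smul_mem_V0_of_mem_idealI hc p))
    (D.V0.smul_mem _ (D.smul_mem_V0_of_mem_idealI (D.star_mem_idealI c hc) q))

lemma h_skew (c : RamExt R x) (p q u v : V) : D.h (D.skew c p q u) v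
    = star c * D.h u q * D.h p v - c * D.h u p * D.h q v := by
  rw [skew_apply, map_sub, LinearMap.sub_apply, h_smul_left, h_smul_left, h_smul_left, h_smul_left,
    ← D.hermitian, ← D.hermitian, star_star]
  ring

lemma skew_isSkew (c : RamExt R x) (p q u v : V) :
    D.h (D.skew c p q u) v + D.h u (D.skew c p q v) = 0 := by
  rw [h_skew, skew_apply, map_sub, h_smul_right, h_smul_right, h_smul_right, h_smul_right]
  ring

/-- Such a `g` fixes `V₀` pointwise, so replacing `w` by `w + u` changes the exponent only by
`h(w,u)` plus its conjugate, which `μ` kills. -/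
lemma beta_congruence_add {g : D.unitaryGroup} (hg : ∀ u, g.1 u - u ∈ D.V0) {v w : V}
    (hvw : v - w ∈ D.V0) : D.beta v g = D.beta w g := by
  obtain ⟨u, hu, rfl⟩ : ∃ u ∈ D.V0, w + u = v := ⟨v - w, hvw, by simp⟩
  have hgu : g.1 u = u := by
    have h1 := D.map_V0_eq_zero (k := (g.1 : V →ₗ[RamExt R x] V) - LinearMap.id) hg hu
    exact sub_eq_zero.mp h1
  have h1 : D.h (g.1 w) u = D.h w u := by
    have h2 := D.h_V0_V0 (hg w) hu
    rwa [map_sub, LinearMap.sub_apply, sub_eq_zero] at h2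
  have h3 : D.h (g.1 (w + u)) (w + u) = D.h (g.1 w) w + (D.h w u + star (D.h w u)) := by
    rw [map_add g.1, hgu, map_add, map_add, LinearMap.add_apply, LinearMap.add_apply, h1,
      D.h_V0_V0 hu hu, D.hermitian w u]
    ring
  rw [beta, beta, h3, AddChar.map_add_eq_mul, mu_add_star, mul_one]

/-- On `1 + skew c p q` the character at `u` is `μ(-2c h(u,p)h(q,u))`. Letting `c` run through `𝔦`,
primitivity of `μ` forces the difference of the two products to annihilate `𝔦`, that is, to lie in
`𝔦`. -/
lemma h_mul_h_sub_mem_idealI (h2 : IsUnit (2 : R)) {v w : V}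
    (h : ∀ g : D.unitaryGroup, (∀ u, g.1 u - u ∈ D.V0) → D.beta v g = D.beta w g) (p q : V) :
    D.h w p * D.h q w - D.h v p * D.h q v ∈ D.idealI := by
  have hbeta : ∀ (c : RamExt R x) (hc : c ∈ D.idealI) (u : V),
      D.beta u (D.congruenceElt (D.skew c p q) (D.skew_mem_V0 hc p q) (D.skew_isSkew c p q))
        = D.mu (-(2 * (c * (D.h u p * D.h q u)))) := by
    intro c hc u
    have h1 : D.h (D.skew c p q u) u
        = star (c * (D.h u p * D.h q u)) + -(c * (D.h u p * D.h q u)) := by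
      rw [h_skew, star_mul, star_mul, ← D.hermitian, ← D.hermitian]
      ring
    rw [beta, congruenceElt_apply, map_add, LinearMap.add_apply, AddChar.map_add_eq_mul,
      D.mu_h_self, one_mul, h1, AddChar.map_add_eq_mul, mu_star, ← AddChar.map_add_eq_mul]
    congr 1
    ring
  set d := D.h w p * D.h q w - D.h v p * D.h q v with hd
  have h20 : (2 * (d * omega ^ D.ell) : RamExt R x) = 0 := by
    refine D.mu_primitive h2 fun b => ?_
    have hc : b * omega ^ D.ell ∈ D.idealI := D.mem_idealI.mpr ⟨b, rfl⟩
    have h3 := h (D.congruenceElt (D.skew _ p q) (D.skew_mem_V0 hc p q) (D.skew_isSkew _ p q))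
      (fun u => by
        rw [congruenceElt_apply, add_sub_cancel_left]
        exact D.skew_mem_V0 hc p q u)
    rw [hbeta _ hc, hbeta _ hc] at h3
    have h4 : 2 * (d * omega ^ D.ell) * b = -(2 * (b * omega ^ D.ell * (D.h v p * D.h q v)))
        - -(2 * (b * omega ^ D.ell * (D.h w p * D.h q w))) := by
      rw [hd]
      ring
    rw [h4, AddChar.map_sub_eq_div, h3, div_self]
    exact (AddChar.val_isUnit _ _).ne_zero
  rw [mem_idealI_iff_mul_omega_pow]
  have h5 : IsUnit (2 : RamExt R x) := by
    have := h2.map (algebraMap R (RamExt R x))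
    rwa [map_ofNat] at this
  exact h5.mul_right_eq_zero.mp h20

/-- The characters `β_v` separate the `N`-orbits of primitive vectors modulo `V₀`. -/
lemma exists_congruence_beta_ne [Module.Free (RamExt R x) V] [Module.Finite (RamExt R x) V]
    (h2 : IsUnit (2 : R)) {v w : V} (hw : D.IsPrimitiveVec w)
    (hvw : ¬ ∃ z : D.NormOne, (z : RamExt R x) • v - w ∈ D.V0) :
    ∃ g : D.unitaryGroup, (∀ u, g.1 u - u ∈ D.V0) ∧ D.beta v g ≠ D.beta w g := by
  by_contra! h
  apply hvw
  have key := D.h_mul_h_sub_mem_idealI h2 h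
  obtain ⟨p, hp⟩ := D.exists_h_eq_one hw
  -- Since `h(w,p) = 1`, the congruence says that `h(q, w - h(v,p)v)` lies in `𝔦` for all `q`.
  have h1 : w - D.h v p • v ∈ D.V0 := by
    refine D.mem_V0_of_forall fun q => ?_
    have h3 := key p q
    rwa [hp, one_mul, ← h_smul_right, ← map_sub] at h3
  -- The case `q = p` shows that the scalar `h(v,p)` has norm one modulo `𝔦`.
  have h3 : D.h v p * star (D.h v p) - 1 ∈ D.idealI := by
    have h4 := key p p
    rw [D.hermitian w p, D.hermitian v p, hp, star_one, mul_one] at h4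
    rw [← neg_sub]
    exact neg_mem h4
  obtain ⟨z, hz⟩ := D.exists_normOne_of_mul_star_sub_one_mem h2 h3
  refine ⟨z, ?_⟩
  have h5 := sub_mem (D.smul_mem_V0_of_mem_idealI hz v) h1
  convert h5 using 1
  rw [sub_smul]
  abel

/-! ### The vectors `e_v` -/

lemma weil_e (g : D.unitaryGroup) (v : V) : D.weil g (D.e v) = D.e (g.1 v) := by
  have hg : (SemidirectProduct.inr g⁻¹ : D.Big) ∈ D.smallSubgroup := D.V0.zero_mem
  have h1 : (SemidirectProduct.inl (⟨0, v⟩ : Heis D) : D.Big)⁻¹ * (SemidirectProduct.inr g)⁻¹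
      = ((⟨SemidirectProduct.inr g⁻¹, hg⟩ : D.smallSubgroup) : D.Big)
        * (SemidirectProduct.inl (⟨0, g.1 v⟩ : Heis D))⁻¹ := by
    change _ = SemidirectProduct.inr g⁻¹ * _
    rw [map_inv, ← mul_inv_rev, ← mul_inv_rev, inv_inj]
    have h2 := SemidirectProduct.inl_aut (φ := D.heisAction) g (⟨0, v⟩ : Heis D)
    have h3 : D.heisAction g (⟨0, v⟩ : Heis D) = ⟨0, g.1 v⟩ := rfl
    rw [← h3, h2, map_inv, inv_mul_cancel_right]
  have h4 : D.smallChar ⟨SemidirectProduct.inr g⁻¹, hg⟩ = 1 :=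
    Units.ext D.mu.map_zero_eq_one
  change Representation.ind D.smallSubgroup.subtype (linearRep D.smallChar)
    (SemidirectProduct.inr g) (D.e v) = _
  rw [e, Representation.ind_mk, h1, indMk_mul, h4, inv_one, one_smul]
  rfl

/-- Write `(0, v + u) = (0, v)(-h(v,u), u)` and let the second factor act on `ζ` through `μ`. -/
lemma e_eq_smul_e {v w : V} (h : w - v ∈ D.V0) : D.e w = D.mu (D.h w v) • D.e v := by
  obtain ⟨u, hu, rfl⟩ : ∃ u ∈ D.V0, v + u = w := ⟨w - v, h, by simp⟩
  have hb : (SemidirectProduct.inl (⟨-D.h v u, u⟩ : Heis D) : D.Big) ∈ D.smallSubgroup := hu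
  have h1 : (SemidirectProduct.inl (⟨0, v + u⟩ : Heis D) : D.Big)⁻¹
      = (((⟨_, hb⟩ : D.smallSubgroup)⁻¹ : D.smallSubgroup) : D.Big)
        * (SemidirectProduct.inl (⟨0, v⟩ : Heis D))⁻¹ := by
    rw [Subgroup.coe_inv, ← mul_inv_rev, inv_inj, ← map_mul, Heis.mul_def]
    simp
  have h4 : (D.smallChar ⟨_, hb⟩ : ℂ) = D.mu (-D.h v u) := rfl
  have h5 : D.mu (D.h (v + u) v) = D.mu (-D.h v u) := by
    rw [map_add, LinearMap.add_apply, AddChar.map_add_eq_mul, mu_h_self, one_mul, D.hermitian v u,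
      mu_star]
  rw [e, h1, indMk_mul, map_inv, inv_inv, h5, ← h4]
  rfl

open Classical in
/-- The coordinate at `v` on the induced module, as a function on `H ⋊ U`. -/
def coordFun (v : V) (k : D.Big) : ℂ :=
  if (k⁻¹).left.vec - v ∈ D.V0 then D.mu ((k⁻¹).left.scal + D.h (k⁻¹).left.vec v) else 0

lemma coordFun_mul (v : V) (b : D.smallSubgroup) (k : D.Big) :
    (D.smallChar b : ℂ) • D.coordFun v (b * k) = D.coordFun v k := by
  -- The coordinate function looks at inverses, so it is convenient to write `b` itself as an
  -- inverse.
  obtain ⟨b, rfl⟩ : ∃ b' : D.smallSubgroup, b'⁻¹ = b := ⟨b⁻¹, inv_inv b⟩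
  have hvec : ((((b⁻¹ : D.smallSubgroup) : D.Big) * k)⁻¹).left.vec
      = (k⁻¹).left.vec + (k⁻¹).right.1 b.1.left.vec := by
    rw [mul_inv_rev, Subgroup.coe_inv, inv_inv]
    rfl
  have hscal : ((((b⁻¹ : D.smallSubgroup) : D.Big) * k)⁻¹).left.scal
      = (k⁻¹).left.scal + b.1.left.scal
        + D.h (k⁻¹).left.vec ((k⁻¹).right.1 b.1.left.vec) := by
    rw [mul_inv_rev, Subgroup.coe_inv, inv_inv]
    rfl
  set w := (k⁻¹).left.vec with hw
  set u := (k⁻¹).right.1 b.1.left.vec with hu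
  have hu0 : u ∈ D.V0 := D.smul_mem_V0 _ b.2
  have hiff : w + u - v ∈ D.V0 ↔ w - v ∈ D.V0 := by
    rw [add_sub_right_comm]
    exact D.V0.add_mem_iff_left hu0
  have hχ : (D.smallChar b : ℂ) = D.mu b.1.left.scal := rfl
  rw [coordFun, coordFun, hvec, hscal, ← hw]
  by_cases h : w - v ∈ D.V0
  · rw [if_pos h, if_pos (hiff.mpr h), map_inv, ← Units.smul_def, inv_smul_eq_iff, Units.smul_def,
      hχ, smul_eq_mul, ← AddChar.map_add_eq_mul]
    have h1 : D.h w u = D.h v u := by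
      have h2 := D.h_V0_V0 h hu0
      rwa [map_sub, LinearMap.sub_apply, sub_eq_zero] at h2
    have h3 : (k⁻¹).left.scal + b.1.left.scal + D.h w u + D.h (w + u) v
        = (b.1.left.scal + ((k⁻¹).left.scal + D.h w v)) + (D.h v u + star (D.h v u)) := by
      rw [h1, map_add, LinearMap.add_apply, ← D.hermitian]
      ring
    rw [h3, AddChar.map_add_eq_mul, mu_add_star, mul_one]
  · rw [if_neg h, if_neg (hiff.not.mpr h), smul_zero]

/-- The coordinate at `v` on the space `X`. -/
def coord (v : V) : D.X →ₗ[ℂ] ℂ := indLift D.smallChar (D.coordFun v) (D.coordFun_mul v)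

open Classical in
lemma coord_e (v w : V) : D.coord v (D.e w) = if w - v ∈ D.V0 then D.mu (D.h w v) else 0 := by
  rw [coord, e, indLift_mk, one_smul, coordFun, inv_inv]
  simp

lemma linearIndependent_e {T : Set V} (hT : D.IsTransversal T) :
    LinearIndependent ℂ fun t : T => D.e t := by
  classical
  rw [linearIndependent_iff']
  intro s c hc t ht
  have h1 := congrArg (D.coord (t : V)) hc
  rw [map_sum, map_zero, Finset.sum_eq_single t] at h1
  · simpa [coord_e, mu_h_self] using h1
  · intro t' _ htt
    rw [map_smul, coord_e, if_neg, smul_zero]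
    intro h2
    obtain ⟨t₀, -, huniq⟩ := hT t'
    have h3 := huniq t ⟨t.2, h2⟩
    have h4 := huniq t' ⟨t'.2, by simp⟩
    exact htt (Subtype.ext (h4.trans h3.symm))
  · intro h2
    exact absurd ht h2

lemma e_mem_topSpace {T : Set V} (hT : D.IsTransversal T) {v : V} (hv : D.IsPrimitiveVec v) :
    D.e v ∈ D.topSpace T := by
  obtain ⟨t, ⟨ht, hvt⟩, -⟩ := hT v
  rw [D.e_eq_smul_e hvt]
  exact Submodule.smul_mem _ _
    (Submodule.subset_span ⟨t, ⟨ht, D.isPrimitiveVec_of_sub_mem hvt hv⟩, rfl⟩)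

/-! ### The vectors `E_{φ,v}` -/

lemma scalar_mul_comm (z : D.NormOne) (g : D.unitaryGroup) : D.scalar z * g = g * D.scalar z := by
  apply Subtype.ext
  apply LinearEquiv.ext
  intro v
  exact (map_smul g.1 (z : RamExt R x) v).symm

lemma weil_scalar_comm (z : D.NormOne) (g : D.unitaryGroup) (w : D.X) :
    D.weil (D.scalar z) (D.weil g w) = D.weil g (D.weil (D.scalar z) w) := by
  rw [← Module.End.mul_apply, ← map_mul, scalar_mul_comm, map_mul, Module.End.mul_apply]

lemma E_eq_sum [Fintype D.NormOne] (δ φ : D.NormOne →* ℂˣ) (v : V) :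
    D.E δ φ v = ∑ z : D.NormOne,
      ((φ z⁻¹ : ℂ) * (δ z⁻¹ : ℂ)) • D.weil (D.scalar z) (D.e v) :=
  finsum_eq_sum_of_fintype _

/-- The subgroup `N ∩ (1 + 𝔦)` of `N`. -/
def normOneCongr : Subgroup D.NormOne where
  carrier := {z | (z : RamExt R x) - 1 ∈ D.idealI}
  one_mem' := by simp
  mul_mem' {a b} ha hb := by
    have h1 := D.idealI.add_mem (D.idealI.mul_mem_left (a : RamExt R x) hb) ha
    have h2 : (a : RamExt R x) * ((b : RamExt R x) - 1) + ((a : RamExt R x) - 1)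
        = ((a * b : D.NormOne) : RamExt R x) - 1 := by
      rw [Submonoid.coe_mul]
      ring
    rwa [h2] at h1
  inv_mem' {a} ha := by
    have h1 := D.star_mem_idealI _ ha
    rwa [star_sub, star_one] at h1

lemma beta_scalar (v : V) (z : D.NormOne) :
    D.beta v (D.scalar z) = D.mu (star (z : RamExt R x) * D.h v v) := by
  rw [beta, scalar_apply, h_smul_left]

/-- From `(z* - 1)(w* - 1) = 0` follows `(zw)* = z* + w* - 1`, and `μ(h(v,v)) = 1`. -/
lemma beta_scalar_mul (v : V) {z w : D.NormOne} (hz : z ∈ D.normOneCongr)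
    (hw : w ∈ D.normOneCongr) : D.beta v (D.scalar (z * w))
      = D.beta v (D.scalar z) * D.beta v (D.scalar w) := by
  have h1 := D.mul_eq_zero_of_mem_idealI (D.star_mem_idealI _ hz) (D.star_mem_idealI _ hw)
  rw [star_sub, star_sub, star_one] at h1
  have h3 : star (z : RamExt R x) * D.h v v + star (w : RamExt R x) * D.h v v
      = star ((z * w : D.NormOne) : RamExt R x) * D.h v v + D.h v v := by
    rw [Submonoid.coe_mul, star_mul]
    linear_combination (-D.h v v) * h1
  rw [beta_scalar, beta_scalar, beta_scalar, ← AddChar.map_add_eq_mul, h3, AddChar.map_add_eq_mul,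
    mu_h_self, mul_one]

section Finite

variable [Finite R]

instance finite_normOne : Finite D.NormOne := Subtype.finite

lemma weil_scalar_E (δ φ : D.NormOne →* ℂˣ) (v : V) (z : D.NormOne) :
    D.weil (D.scalar z) (D.E δ φ v) = ((φ z : ℂ) * (δ z : ℂ)) • D.E δ φ v := by
  have := Fintype.ofFinite D.NormOne
  rw [E_eq_sum, map_sum, Finset.smul_sum]
  refine Fintype.sum_equiv (Equiv.mulLeft z) _ _ fun w => ?_
  rw [map_smul, ← Module.End.mul_apply, ← map_mul, ← map_mul, smul_smul]
  congr 1
  simp only [Equiv.coe_mulLeft, mul_inv_rev, map_mul, map_inv, Units.val_mul]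
  have h1 : (φ z : ℂ) ≠ 0 := Units.ne_zero _
  have h2 : (δ z : ℂ) ≠ 0 := Units.ne_zero _
  simp only [Units.val_inv_eq_inv_val]
  field_simp

omit [Finite R] in
lemma weil_weil_scalar_e {v : V} {g : D.unitaryGroup} {z : D.NormOne} {c : ℂ}
    (h : D.weil g (D.e v) = c • D.weil (D.scalar z) (D.e v)) (w : D.NormOne) :
    D.weil g (D.weil (D.scalar w) (D.e v))
      = c • D.weil (D.scalar z) (D.weil (D.scalar w) (D.e v)) :=
  calc _ = D.weil (D.scalar w) (D.weil g (D.e v)) := (D.weil_scalar_comm w g (D.e v)).symm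
    _ = D.weil (D.scalar w) (c • D.weil (D.scalar z) (D.e v)) := congrArg _ h
    _ = c • D.weil (D.scalar w) (D.weil (D.scalar z) (D.e v)) := map_smul _ _ _
    _ = _ := congrArg (c • ·) (D.weil_scalar_comm w (D.scalar z) (D.e v))

lemma weil_E_of_weil_e (δ φ : D.NormOne →* ℂˣ) {v : V} {g : D.unitaryGroup} {z : D.NormOne} {c : ℂ}
    (h : D.weil g (D.e v) = c • D.weil (D.scalar z) (D.e v)) :
    D.weil g (D.E δ φ v) = c • D.weil (D.scalar z) (D.E δ φ v) := by
  have := Fintype.ofFinite D.NormOne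
  rw [E_eq_sum]
  exact map_sum_smul_eq_smul_map _ (D.weil_weil_scalar_e h)

/-- Every element of `C(v)N` stabilizes the line of `E_{φ,v}`: it moves `e_v` as a scalar of norm
one does, up to a factor, and `N` acts on `E_{φ,v}` by `φδ`. -/
lemma weil_E_of_sub_mem (δ φ : D.NormOne →* ℂˣ) {v : V} {g : D.unitaryGroup} {z : D.NormOne}
    (h : g.1 v - (z : RamExt R x) • v ∈ D.V0) : ∃ c : ℂ, D.weil g (D.E δ φ v) = c • D.E δ φ v := by
  have h1 : D.weil g (D.e v)
      = D.mu (D.h (g.1 v) ((D.scalar z).1 v)) • D.weil (D.scalar z) (D.e v) := by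
    rw [weil_e, weil_e]
    exact D.e_eq_smul_e h
  refine ⟨D.mu (D.h (g.1 v) ((D.scalar z).1 v)) * ((φ z : ℂ) * (δ z : ℂ)), ?_⟩
  rw [mul_smul, ← weil_scalar_E]
  exact D.weil_E_of_weil_e δ φ h1

lemma weil_E_congruence (δ φ : D.NormOne →* ℂˣ) {v : V} {g : D.unitaryGroup}
    (hg : ∀ u, g.1 u - u ∈ D.V0) : D.weil g (D.E δ φ v) = D.beta v g • D.E δ φ v := by
  have h1 : D.weil g (D.e v) = D.beta v g • D.weil (D.scalar 1) (D.e v) := by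
    rw [weil_e, map_one, map_one, Module.End.one_apply]
    exact D.e_eq_smul_e (hg v)
  have h3 := D.weil_E_of_weil_e δ φ h1
  rwa [map_one, map_one, Module.End.one_apply] at h3

lemma card_normOne_congr_ne_zero :
    (Nat.card {z : D.NormOne // (z : RamExt R x) - 1 ∈ D.idealI} : ℂ) ≠ 0 := by
  have : Nonempty {z : D.NormOne // (z : RamExt R x) - 1 ∈ D.idealI} := ⟨⟨1, by simp⟩⟩
  exact Nat.cast_ne_zero.mpr Nat.card_pos.ne'

lemma exists_charGroup_apply_ne_one {z : D.NormOne} (hz : (z : RamExt R x) - 1 ∉ D.idealI) :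
    ∃ φ ∈ D.charGroup, φ z ≠ 1 := by
  have h1 := (CommGroup.forall_monoidHom_apply_eq_one_iff ℂ D.normOneCongr z).not.mpr hz
  push Not at h1
  exact h1

/-- As `-2` is a unit, `-1` is not congruent to `1` modulo `𝔦`, so some character in `G` is
non-trivial at this element of order two. -/
lemma exists_charGroup_neg_one (h2 : IsUnit (2 : R)) : ∃ φ ∈ D.charGroup, φ (-1) = -1 := by
  have h1 : ((-1 : D.NormOne) : RamExt R x) - 1 ∉ D.idealI := by
    intro h
    have h3 := D.idealI_le_rad h
    rw [mem_rad_iff] at h3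
    have h4 : (((-1 : D.NormOne) : RamExt R x) - 1).re = -2 := by
      rw [Unitary.coe_neg]
      simp
      norm_num
    rw [h4] at h3
    exact h3 h2.neg
  obtain ⟨φ, hφ, hne⟩ := D.exists_charGroup_apply_ne_one h1
  refine ⟨φ, hφ, ?_⟩
  have h5 : φ (-1) * φ (-1) = 1 := by
    rw [← map_mul]
    simp
  have h6 : ((φ (-1) : ℂˣ) : ℂ) * (φ (-1) : ℂˣ) = 1 := by
    rw [← Units.val_mul, h5, Units.val_one]
  rcases mul_self_eq_one_iff.mp h6 with h7 | h7
  · exact absurd (Units.ext h7) hne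
  · exact Units.ext h7

section Primitive

variable [Module.Free (RamExt R x) V] [Module.Finite (RamExt R x) V]

/-- Only `z ≡ 1` modulo `𝔦` reaches the coordinate at `v`; there `φ` is trivial and `δ(z⁻¹)` cancels
the factor `β_v(z)`. The value serves to show `E_{φ,v} ≠ 0`. -/
lemma coord_E {δ φ : D.NormOne →* ℂˣ} {v : V} (hv : D.IsPrimitiveVec v) (hδ : D.Extends v δ)
    (hφ : φ ∈ D.charGroup) :
    D.coord v (D.E δ φ v) = Nat.card {z : D.NormOne // (z : RamExt R x) - 1 ∈ D.idealI} := by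
  classical
  have := Fintype.ofFinite D.NormOne
  have h1 : ∀ z : D.NormOne, D.coord v
      (((φ z⁻¹ : ℂ) * (δ z⁻¹ : ℂ)) • D.weil (D.scalar z) (D.e v))
        = if (z : RamExt R x) - 1 ∈ D.idealI then 1 else 0 := by
    intro z
    rw [map_smul, weil_e, coord_e]
    have h2 : (D.scalar z).1 v - v ∈ D.V0 ↔ (z : RamExt R x) - 1 ∈ D.idealI :=
      D.scalar_mem_stab_iff hv z
    by_cases hz : (z : RamExt R x) - 1 ∈ D.idealI
    · rw [if_pos hz, if_pos (h2.mpr hz)]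
      have h3 := hδ z (h2.mpr hz)
      rw [beta] at h3
      rw [← h3, map_inv, map_inv, hφ z hz]
      simp
    · rw [if_neg hz, if_neg (h2.not.mpr hz), smul_zero]
  rw [E_eq_sum, map_sum, Finset.sum_congr rfl fun z _ => h1 z, Finset.sum_boole,
    Nat.card_eq_fintype_card, Fintype.card_subtype]

lemma E_ne_zero {δ φ : D.NormOne →* ℂˣ} {v : V} (hv : D.IsPrimitiveVec v) (hδ : D.Extends v δ)
    (hφ : φ ∈ D.charGroup) : D.E δ φ v ≠ 0 := by
  intro h0
  have h1 := D.coord_E hv hδ hφ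
  rw [h0, map_zero] at h1
  exact D.card_normOne_congr_ne_zero h1.symm

/-- Orthogonality for `G`: the sum over `φ` kills every `z` outside `1 + 𝔦`, and each remaining `z`
contributes the same multiple of `e_v`. -/
lemma exists_sum_E {δ : D.NormOne →* ℂˣ} {v : V} (hv : D.IsPrimitiveVec v)
    (hδ : D.Extends v δ) : ∃ s : Finset (D.NormOne →* ℂˣ), (∀ φ ∈ s, φ ∈ D.charGroup) ∧
      ∃ c : ℂ, c ≠ 0 ∧ ∑ φ ∈ s, D.E δ φ v = c • D.e v := by
  classical
  have := Fintype.ofFinite D.NormOne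
  have := Fintype.ofFinite (D.NormOne →* ℂˣ)
  let s : Finset (D.NormOne →* ℂˣ) := Finset.univ.filter (· ∈ D.charGroup)
  have hs : ∀ φ, φ ∈ s ↔ φ ∈ D.charGroup := by simp [s]
  refine ⟨s, fun φ => (hs φ).mp, (s.card : ℂ) *
    Nat.card {z : D.NormOne // (z : RamExt R x) - 1 ∈ D.idealI}, ?_, ?_⟩
  · refine mul_ne_zero (Nat.cast_ne_zero.mpr ?_) D.card_normOne_congr_ne_zero
    exact Finset.card_ne_zero_of_mem ((hs 1).mpr D.charGroup.one_mem)
  · have key : ∀ z : D.NormOne, (∑ φ ∈ s, ((φ z⁻¹ : ℂ) * (δ z⁻¹ : ℂ)) •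
        D.weil (D.scalar z) (D.e v))
          = if (z : RamExt R x) - 1 ∈ D.idealI then (s.card : ℂ) • D.e v else 0 := by
      intro z
      split_ifs with hz
      · have h1 : D.weil (D.scalar z) (D.e v) = (δ z : ℂ) • D.e v := by
          rw [weil_e, D.e_eq_smul_e ((D.scalar_mem_stab_iff hv z).mpr hz),
            hδ z ((D.scalar_mem_stab_iff hv z).mpr hz)]
          rfl
        rw [h1, Finset.sum_congr rfl (g := fun _ => D.e v), Finset.sum_const, Nat.cast_smul_eq_nsmul]
        intro φ hφ
        rw [map_inv, map_inv, (hs φ).mp hφ z hz, smul_smul]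
        simp
      · obtain ⟨ψ, hψ, hne⟩ := D.exists_charGroup_apply_ne_one hz
        rw [← Finset.sum_smul, ← Finset.sum_mul]
        have h1 : (ψ z⁻¹ : ℂ) * ∑ φ ∈ s, (φ z⁻¹ : ℂ) = ∑ φ ∈ s, (φ z⁻¹ : ℂ) := by
          rw [Finset.mul_sum]
          refine Finset.sum_equiv (Equiv.mulLeft ψ) (fun φ => ?_) (fun φ _ => ?_)
          · rw [hs, hs, Equiv.coe_mulLeft, D.charGroup.mul_mem_cancel_left hψ]
          · simp
        have h2 : (∑ φ ∈ s, (φ z⁻¹ : ℂ)) = 0 := by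
          by_contra h0
          have h3 := mul_right_cancel₀ h0 (h1.trans (one_mul _).symm)
          rw [Units.val_eq_one, map_inv, inv_eq_one] at h3
          exact hne h3
        rw [h2, zero_mul, zero_smul]
    simp_rw [E_eq_sum]
    rw [Finset.sum_comm, Finset.sum_congr rfl fun z _ => key z, ← Finset.sum_filter,
      Finset.sum_const, Nat.card_eq_fintype_card, Fintype.card_subtype, ← Nat.cast_smul_eq_nsmul ℂ,
      smul_smul, mul_comm]

/-- Characters of a subgroup of the finite abelian group `N` extend to `N`. If the extension is `-1`
at `-1`, a twist by a character in `G` with the same value repairs this without affecting `C(v) ∩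
N`. -/
lemma exists_extends (h2 : IsUnit (2 : R)) {v : V} (hv : D.IsPrimitiveVec v) :
    ∃ δ : D.NormOne →* ℂˣ, D.Extends v δ ∧ δ (-1) = 1 := by
  let β : D.normOneCongr →* ℂˣ := MonoidHom.toHomUnits
    { toFun := fun z => D.beta v (D.scalar z)
      map_one' := by
        rw [Subgroup.coe_one, beta_scalar, Submonoid.coe_one, star_one, one_mul, mu_h_self]
      map_mul' := fun z w => D.beta_scalar_mul v z.2 w.2 }
  obtain ⟨δ, hδ⟩ := MonoidHom.domRestrict_surjective ℂ D.normOneCongr β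
  have hext : ∀ z : D.NormOne, z ∈ D.normOneCongr → (δ z : ℂ) = D.beta v (D.scalar z) := by
    intro z hz
    have h1 := congrArg Units.val (DFunLike.congr_fun hδ ⟨z, hz⟩)
    exact h1
  have hsq : δ (-1) * δ (-1) = 1 := by
    rw [← map_mul]
    simp
  have h6 : ((δ (-1) : ℂˣ) : ℂ) * (δ (-1) : ℂˣ) = 1 := by
    rw [← Units.val_mul, hsq, Units.val_one]
  rcases mul_self_eq_one_iff.mp h6 with h7 | h7
  · exact ⟨δ, fun z hz => hext z ((D.scalar_mem_stab_iff hv z).mp hz), Units.ext h7⟩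
  · obtain ⟨φ, hφ, hφ1⟩ := D.exists_charGroup_neg_one h2
    refine ⟨δ * φ, fun z hz => ?_, ?_⟩
    · have hz' := (D.scalar_mem_stab_iff hv z).mp hz
      rw [MonoidHom.mul_apply, hφ z hz', mul_one]
      exact hext z hz'
    · apply Units.ext
      rw [MonoidHom.mul_apply, hφ1, Units.val_mul, h7]
      simp

end Primitive

end Finite

/-! ### The number of primitive vectors modulo `V₀` -/

lemma card_eq_ncard_mul_card_V0 {T : Set V} (hT : D.IsTransversal T)
    {M : Submodule (RamExt R x) V} (hM : D.V0 ≤ M) :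
    Nat.card M = {t | t ∈ T ∧ t ∈ M}.ncard * Nat.card D.V0 := by
  rw [← Nat.card_coe_set_eq, ← Nat.card_prod]
  let f : {t | t ∈ T ∧ t ∈ M} × D.V0 → M := fun p => ⟨p.1 + p.2, add_mem p.1.2.2 (hM p.2.2)⟩
  refine (Nat.card_congr (Equiv.ofBijective f ⟨?_, ?_⟩)).symm
  · rintro ⟨⟨t, ht⟩, ⟨u, hu⟩⟩ ⟨⟨t', ht'⟩, ⟨u', hu'⟩⟩ h
    have h1 : t + u = t' + u' := congrArg Subtype.val h
    obtain ⟨t₀, -, huniq⟩ := hT (t + u)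
    have h3 := huniq t ⟨ht.1, by simpa using hu⟩
    have h4 := huniq t' ⟨ht'.1, by rw [h1]; simpa using hu'⟩
    obtain rfl : t = t' := h3.trans h4.symm
    obtain rfl : u = u' := add_left_cancel h1
    rfl
  · rintro ⟨v, hv⟩
    obtain ⟨t, ⟨ht, hvt⟩, -⟩ := hT v
    have htM : t ∈ M := by
      have := sub_mem hv (hM hvt)
      rwa [sub_sub_cancel] at this
    exact ⟨⟨⟨t, ht, htM⟩, ⟨v - t, hvt⟩⟩, Subtype.ext (by simp [f])⟩

omit [IsLocalRing R] in
-- In coordinates `aV` is a power of the ideal `Aa`; the cases `y ^ ℓ`, `y` and `1` give `V₀`, `𝔯V`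
-- and `V`.
lemma card_span_singleton_smul_top [Module.Free (RamExt R x) V] [Module.Finite (RamExt R x) V]
    [Nontrivial R] (a : RamExt R x) :
    Nat.card (Ideal.span {a} • ⊤ : Submodule (RamExt R x) V)
      = Nat.card (Ideal.span {a}) ^ Module.finrank (RamExt R x) V := by
  let b := Module.Free.chooseBasis (RamExt R x) V
  have hmem : ∀ v : V, v ∈ (Ideal.span {a} • ⊤ : Submodule (RamExt R x) V) ↔
      ∀ i, b.equivFun v i ∈ Ideal.span {a} := by
    intro v
    rw [Submodule.ideal_span_singleton_smul, Submodule.mem_smul_pointwise_iff_exists]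
    constructor
    · rintro ⟨w, -, rfl⟩ i
      rw [map_smul]
      exact Ideal.mul_mem_right _ _ (Ideal.mem_span_singleton_self a)
    · intro h
      simp_rw [Ideal.mem_span_singleton'] at h
      choose c hc using h
      refine ⟨b.equivFun.symm c, trivial, ?_⟩
      apply b.equivFun.injective
      funext i
      rw [map_smul, LinearEquiv.apply_symm_apply, Pi.smul_apply, smul_eq_mul, mul_comm, hc]
  have e1 : (Ideal.span {a} • ⊤ : Submodule (RamExt R x) V) ≃
      {f : Module.Free.ChooseBasisIndex (RamExt R x) V → RamExt R x //
        ∀ i, f i ∈ Ideal.span {a}} :=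
    b.equivFun.toEquiv.subtypeEquiv hmem
  rw [Nat.card_congr (e1.trans Equiv.subtypePiEquivPi), Nat.card_pi, Finset.prod_const,
    Finset.card_univ, Module.finrank_eq_card_chooseBasisIndex]

lemma ncard_primitive [Finite R] [Module.Free (RamExt R x) V] [Module.Finite (RamExt R x) V]
    {T : Set V} (hT : D.IsTransversal T) :
    ({t | t ∈ T ∧ D.IsPrimitiveVec t}.ncard : ℚ)
      = (Nat.card (IsLocalRing.ResidueField R) : ℚ) ^ (D.ell * Module.finrank (RamExt R x) V)
        - (Nat.card (IsLocalRing.ResidueField R) : ℚ)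
          ^ ((D.ell - 1) * Module.finrank (RamExt R x) V) := by
  set m := Module.finrank (RamExt R x) V with hm
  set q := Nat.card (IsLocalRing.ResidueField R) with hq
  have : Finite V := Module.finite_of_finite (RamExt R x)
  have hq0 : 0 < q := by
    have : Finite (IsLocalRing.ResidueField R) :=
      Finite.of_surjective _ (IsLocalRing.residue_surjective (R := R))
    exact Nat.card_pos
  have hV0 : Nat.card D.V0 = q ^ (D.ell * m) := by
    have h1 := card_span_singleton_smul_top (V := V) ((omega : RamExt R x) ^ D.ell)
    rw [← Ideal.span_singleton_pow] at h1
    change Nat.card D.V0 = Nat.card D.idealI ^ m at h1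
    rw [h1, card_idealI, D.card_eq_card_residueField_pow, pow_mul]
  -- The factor `q ^ m` avoids a subtraction in the exponent.
  have hrad : Nat.card (D.rad • ⊤ : Submodule (RamExt R x) V) * q ^ m
      = q ^ (D.ell * m) * q ^ (D.ell * m) := by
    have h1 := card_span_singleton_smul_top (V := V) (omega : RamExt R x)
    change Nat.card (D.rad • ⊤ : Submodule (RamExt R x) V) = Nat.card D.rad ^ m at h1
    rw [h1, ← mul_pow, card_rad, D.card_eq_card_residueField_pow, mul_pow, pow_mul]
  have htop : Nat.card (⊤ : Submodule (RamExt R x) V) = q ^ (D.ell * m) * q ^ (D.ell * m) := by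
    have h1 := card_span_singleton_smul_top (V := V) (1 : RamExt R x)
    rw [Ideal.span_singleton_one, Submodule.top_smul] at h1
    rw [h1, Nat.card_congr (Submodule.topEquiv (R := RamExt R x)).toEquiv, card_ramExt,
      D.card_eq_card_residueField_pow, mul_pow, pow_mul]
  have hT1 := D.card_eq_ncard_mul_card_V0 hT (M := ⊤) le_top
  have hT2 := D.card_eq_ncard_mul_card_V0 hT D.V0_le_rad_smul_top
  rw [htop, hV0] at hT1
  have hpos : 0 < q ^ (D.ell * m) := pow_pos hq0 _
  have hT1' : {t | t ∈ T ∧ t ∈ (⊤ : Submodule (RamExt R x) V)}.ncard = q ^ (D.ell * m) :=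
    (Nat.eq_of_mul_eq_mul_right hpos hT1).symm
  have hT2' : {t | t ∈ T ∧ t ∈ (D.rad • ⊤ : Submodule (RamExt R x) V)}.ncard
      = q ^ ((D.ell - 1) * m) := by
    rw [hT2, hV0, mul_right_comm] at hrad
    have h1 := Nat.eq_of_mul_eq_mul_right hpos hrad
    have h3 : D.ell * m = (D.ell - 1) * m + m := by
      have := D.ell_pos
      nth_rewrite 1 [← Nat.sub_add_cancel this]
      ring
    rw [h3, pow_add] at h1
    exact Nat.eq_of_mul_eq_mul_right (pow_pos hq0 m) h1
  have hunion : {t | t ∈ T ∧ t ∈ (⊤ : Submodule (RamExt R x) V)}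
      = {t | t ∈ T ∧ D.IsPrimitiveVec t}
        ∪ {t | t ∈ T ∧ t ∈ (D.rad • ⊤ : Submodule (RamExt R x) V)} := by
    ext t
    simp only [IsPrimitiveVec, Set.mem_ofPred_eq, Set.mem_union, Submodule.mem_top]
    tauto
  have hdisj : Disjoint {t | t ∈ T ∧ D.IsPrimitiveVec t}
      {t | t ∈ T ∧ t ∈ (D.rad • ⊤ : Submodule (RamExt R x) V)} := by
    rw [Set.disjoint_left]
    intro t ht ht'
    exact ht.2 ht'.2
  have hcard := congrArg Set.ncard hunion
  rw [Set.ncard_union_eq hdisj, hT1', hT2'] at hcard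
  rw [eq_sub_iff_add_eq]
  exact_mod_cast hcard.symm

lemma finrank_topSpace [Finite R] [Module.Finite (RamExt R x) V] {T : Set V}
    (hT : D.IsTransversal T) :
    Module.finrank ℂ (D.topSpace T) = {t | t ∈ T ∧ D.IsPrimitiveVec t}.ncard := by
  classical
  have : Finite V := Module.finite_of_finite (RamExt R x)
  have := Fintype.ofFinite V
  have hli : LinearIndepOn ℂ D.e T := D.linearIndependent_e hT
  have hli' : LinearIndepOn ℂ D.e {t | t ∈ T ∧ D.IsPrimitiveVec t} := hli.mono fun t ht => ht.1
  have h1 := finrank_span_set_eq_card (R := ℂ) (s := D.e '' {t | t ∈ T ∧ D.IsPrimitiveVec t})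
    hli'.id_image
  rw [topSpace, h1, ← Set.ncard_eq_toFinset_card', hli'.injOn.ncard_image]

/-! ### The monomial system on `Top` -/

lemma weil_mem_topSpace {T : Set V} (hT : D.IsTransversal T) (g : D.unitaryGroup) {w : D.X}
    (hw : w ∈ D.topSpace T) : D.weil g w ∈ D.topSpace T := by
  suffices h : (D.topSpace T).map (D.weil g) ≤ D.topSpace T from
    h (Submodule.mem_map_of_mem hw)
  rw [topSpace, Submodule.map_span_le]
  rintro _ ⟨t, ht, rfl⟩
  rw [weil_e]
  exact D.e_mem_topSpace hT (D.isPrimitiveVec_map g.1 ht.2)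

lemma E_mem_topSpace [Finite R] {T : Set V} (hT : D.IsTransversal T) (δ φ : D.NormOne →* ℂˣ) {v : V}
    (hv : D.IsPrimitiveVec v) : D.E δ φ v ∈ D.topSpace T := by
  have := Fintype.ofFinite D.NormOne
  rw [E_eq_sum]
  exact Submodule.sum_mem _ fun z _ => Submodule.smul_mem _ _
    (D.weil_mem_topSpace hT _ (D.e_mem_topSpace hT hv))

/-- Primitive vectors are equivalent if they agree modulo `V₀` up to a scalar of norm one. -/
def primSetoid : Setoid {v : V // D.IsPrimitiveVec v} where
  r v w := ∃ z : D.NormOne, (z : RamExt R x) • (v : V) - w ∈ D.V0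
  iseqv :=
    { refl := fun v => ⟨1, by simp⟩
      symm := by
        rintro v w ⟨z, hz⟩
        refine ⟨z⁻¹, ?_⟩
        have h1 := D.smul_mem_V0 (D.scalar z⁻¹).1 (neg_mem hz)
        rw [neg_sub, map_sub, scalar_apply, scalar_apply, smul_smul, ← Submonoid.coe_mul,
          inv_mul_cancel, Submonoid.coe_one, one_smul] at h1
        exact h1
      trans := by
        rintro u v w ⟨z, hz⟩ ⟨z', hz'⟩
        refine ⟨z' * z, ?_⟩
        have h1 := add_mem (D.smul_mem_V0 (D.scalar z').1 hz) hz'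
        rw [map_sub, scalar_apply, scalar_apply, sub_add_sub_cancel, smul_smul] at h1
        exact h1 }

/-- The set of classes of primitive vectors under `primSetoid`. -/
abbrev PrimClass : Type _ := Quotient D.primSetoid

section RepSet

variable {D} {T S : Set V} (hS : D.IsRepSet S)

include hS in
lemma IsRepSet.exists_transl (o : D.PrimClass) :
    ∃ (s : S) (g : D.unitaryGroup), g.1 (s : V) - (o.out : V) ∈ D.V0 := by
  obtain ⟨s, ⟨hs, g, hg⟩, -⟩ := hS.2 o.out o.out.2
  refine ⟨⟨s, hs⟩, g⁻¹, ?_⟩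
  have h1 := D.smul_mem_V0 (g⁻¹).1 (neg_mem hg)
  rw [neg_sub, map_sub] at h1
  have h2 : (g⁻¹).1 (g.1 (o.out : V)) = o.out := g.1.symm_apply_apply _
  rwa [h2] at h1

/-- The representative in `S` of a class of primitive vectors. -/
def IsRepSet.rep (o : D.PrimClass) : S := (hS.exists_transl o).choose

/-- A unitary transformation moving the representative in `S` into the given class. -/
def IsRepSet.transl (o : D.PrimClass) : D.unitaryGroup := (hS.exists_transl o).choose_spec.choose

lemma IsRepSet.transl_spec (o : D.PrimClass) :
    (hS.transl o).1 (hS.rep o : V) - (o.out : V) ∈ D.V0 :=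
  (hS.exists_transl o).choose_spec.choose_spec

/-- The class of `v` has a representative in `S` that is `∼`-related to `v`, as is `s`; uniqueness
in `S` identifies the two. -/
lemma IsRepSet.exists_smul_sub_mem {v : V} (hv : D.IsPrimitiveVec v) (g : D.unitaryGroup) (s : S)
    (h : g.1 (s : V) - v ∈ D.V0) :
    ∃ o : D.PrimClass, hS.rep o = s ∧ ∃ z : D.NormOne,
      v - (hS.transl o).1 ((z : RamExt R x) • (s : V)) ∈ D.V0 := by
  let o : D.PrimClass := Quotient.mk _ ⟨v, hv⟩
  obtain ⟨z, hz⟩ : ∃ z : D.NormOne, (z : RamExt R x) • (o.out : V) - v ∈ D.V0 :=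
    Quotient.mk_out (s := D.primSetoid) ⟨v, hv⟩
  have h1 : v - (hS.transl o).1 ((z : RamExt R x) • (hS.rep o : V)) ∈ D.V0 := by
    have h3 := neg_mem (add_mem (D.smul_mem_V0 (D.scalar z).1 (hS.transl_spec o)) hz)
    rw [map_sub, scalar_apply, scalar_apply, sub_add_sub_cancel, neg_sub, ← map_smul] at h3
    exact h3
  have hrep : hS.rep o = s := by
    obtain ⟨s₀, -, huniq⟩ := hS.2 v hv
    have h3 : D.Sim v s := by
      refine ⟨g⁻¹, ?_⟩
      have h4 := D.smul_mem_V0 (g⁻¹).1 (neg_mem h)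
      have h5 : (g⁻¹).1 (g.1 (s : V)) = s := g.1.symm_apply_apply _
      rwa [neg_sub, map_sub, h5] at h4
    have h6 : D.Sim v (hS.rep o) := by
      refine ⟨(hS.transl o * D.scalar z)⁻¹, ?_⟩
      have h4 := D.smul_mem_V0 ((hS.transl o * D.scalar z)⁻¹).1 h1
      have h5 : ((hS.transl o * D.scalar z)⁻¹).1
          ((hS.transl o).1 ((z : RamExt R x) • (hS.rep o : V))) = hS.rep o :=
        (hS.transl o * D.scalar z).1.symm_apply_apply _
      rwa [map_sub, h5] at h4
    exact Subtype.ext ((huniq _ ⟨(hS.rep o).2, h6⟩).trans (huniq _ ⟨s.2, h3⟩).symm)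
  exact ⟨o, hrep, z, hrep ▸ h1⟩

section System

variable [Finite R] (δ : S → D.NormOne →* ℂˣ)

/-- The vector `E_{φ,s}`, for `s` the representative of a class, moved into that class. -/
def IsRepSet.vec (p : D.PrimClass × D.charGroup) : D.X :=
  D.weil (hS.transl p.1) (D.E (δ (hS.rep p.1)) p.2 (hS.rep p.1))

lemma IsRepSet.exists_weil_E_eq (g : D.unitaryGroup) (s : S) (φ : D.charGroup) :
    ∃ (o : D.PrimClass) (c : ℂ), hS.rep o = s ∧
      D.weil g (D.E (δ s) φ s) = c • hS.vec δ (o, φ) := by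
  obtain ⟨o, rfl, z, hz⟩ := hS.exists_smul_sub_mem (D.isPrimitiveVec_map g.1 (hS.1 s s.2)) g s
    (by simp)
  have h1 : ((hS.transl o)⁻¹ * g).1 (hS.rep o : V) - (z : RamExt R x) • (hS.rep o : V) ∈ D.V0 := by
    have h2 := D.smul_mem_V0 ((hS.transl o)⁻¹).1 hz
    have h3 : ((hS.transl o)⁻¹).1 ((hS.transl o).1 ((z : RamExt R x) • (hS.rep o : V)))
        = (z : RamExt R x) • (hS.rep o : V) := (hS.transl o).1.symm_apply_apply _
    rwa [map_sub, h3] at h2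
  obtain ⟨c, hc⟩ := D.weil_E_of_sub_mem (δ (hS.rep o)) φ h1
  refine ⟨o, c, rfl, ?_⟩
  rw [vec, ← map_smul, ← hc, ← Module.End.mul_apply, ← map_mul, mul_inv_cancel_left]

lemma IsRepSet.weil_scalar_vec (z : D.NormOne) (p : D.PrimClass × D.charGroup) :
    D.weil (D.scalar z) (hS.vec δ p)
      = ((p.2.1 z : ℂ) * (δ (hS.rep p.1) z : ℂ)) • hS.vec δ p := by
  rw [vec, weil_scalar_comm, weil_scalar_E, map_smul]

/-- Conjugating `g` by the translating element keeps it congruent to `1` and carries `β` at the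
translate back to `β` at the representative; the error modulo `V₀` does not matter. -/
lemma IsRepSet.weil_congruence_vec {g : D.unitaryGroup} (hg : ∀ u, g.1 u - u ∈ D.V0)
    (p : D.PrimClass × D.charGroup) :
    D.weil g (hS.vec δ p) = D.beta (p.1.out : V) g • hS.vec δ p := by
  set t := hS.transl p.1 with ht
  have hc : ∀ u, (t⁻¹ * g * t).1 u - u ∈ D.V0 := by
    intro u
    have h1 := D.smul_mem_V0 (t⁻¹).1 (hg (t.1 u))
    have h2 : (t⁻¹).1 (t.1 u) = u := t.1.symm_apply_apply _
    rwa [map_sub, h2] at h1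
  have hβ : D.beta (hS.rep p.1 : V) (t⁻¹ * g * t) = D.beta (p.1.out : V) g := by
    rw [← D.beta_congruence_add hg (hS.transl_spec p.1), beta, beta,
      ← t.2 ((t⁻¹ * g * t).1 (hS.rep p.1))]
    have h2 : t.1 ((t⁻¹ * g * t).1 (hS.rep p.1 : V)) = g.1 (t.1 (hS.rep p.1)) :=
      t.1.apply_symm_apply _
    rw [h2]
  have h3 := D.weil_E_congruence (δ (hS.rep p.1)) p.2 (v := hS.rep p.1) hc
  have h4 := congrArg (D.weil t) h3
  rw [map_smul, hβ, ← Module.End.mul_apply, ← map_mul, ← mul_assoc, mul_inv_cancel_left, map_mul,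
    Module.End.mul_apply] at h4
  exact h4

variable [Module.Free (RamExt R x) V] [Module.Finite (RamExt R x) V]

/-- Within one class the factor `δ` is common, so a scalar on which the two `φ` differ separates;
distinct classes are separated by an element congruent to `1`. -/
lemma IsRepSet.separates_vec (h2 : IsUnit (2 : R)) {p p' : D.PrimClass × D.charGroup}
    (hne : p ≠ p') : ∃ (g : D.unitaryGroup) (f : D.PrimClass × D.charGroup → ℂ),
      (∀ q, D.weil g (hS.vec δ q) = f q • hS.vec δ q) ∧ f p ≠ f p' := by
  by_cases ho : p.1 = p'.1
  · have hφ : p.2.1 ≠ p'.2.1 := fun h => hne (Prod.ext ho (Subtype.ext h))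
    obtain ⟨z, hz⟩ := DFunLike.ne_iff.mp hφ
    refine ⟨D.scalar z, fun q => (q.2.1 z : ℂ) * (δ (hS.rep q.1) z : ℂ),
      hS.weil_scalar_vec δ z, ?_⟩
    intro h
    simp only [ho] at h
    exact hz (Units.ext (mul_right_cancel₀ (Units.ne_zero _) h))
  · have hrel : ¬ ∃ z : D.NormOne, (z : RamExt R x) • (p.1.out : V) - p'.1.out ∈ D.V0 := by
      intro h
      apply ho
      rw [← Quotient.out_eq p.1, ← Quotient.out_eq p'.1]
      exact Quotient.sound h
    obtain ⟨g, hg, hgne⟩ := D.exists_congruence_beta_ne h2 p'.1.out.2 hrel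
    exact ⟨g, fun q => D.beta (q.1.out : V) g, hS.weil_congruence_vec δ hg, hgne⟩

/-- The lines spanned by the translates of the `E_{φ,s}` are permuted by the unitary group and
separated by its elements congruent to scalars modulo `𝔦`. -/
def IsRepSet.monomialSystem (h2 : IsUnit (2 : R)) (hδ : ∀ s : S, D.Extends s (δ s)) :
    MonomialSystem D.weil (S × D.charGroup) (D.PrimClass × D.charGroup) where
  head i := D.E (δ i.1) i.2 i.1
  vec := hS.vec δ
  typ p := (hS.rep p.1, p.2)
  transl p := hS.transl p.1
  vec_eq _ := rfl
  typ_surjective := by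
    rintro ⟨s, φ⟩
    obtain ⟨o, -, h, -⟩ := hS.exists_weil_E_eq δ 1 s φ
    exact ⟨(o, φ), Prod.ext h rfl⟩
  vec_ne_zero p h0 := by
    have h1 := congrArg (D.weil (hS.transl p.1)⁻¹) h0
    rw [vec, ← Module.End.mul_apply, ← map_mul, inv_mul_cancel, map_one, map_zero] at h1
    exact D.E_ne_zero (hS.1 _ (hS.rep p.1).2) (hδ _) p.2.2 h1
  permutes g p := by
    obtain ⟨o, c, h, hc⟩ := hS.exists_weil_E_eq δ (g * hS.transl p.1) (hS.rep p.1) p.2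
    refine ⟨(o, p.2), c, Prod.ext h rfl, ?_⟩
    rw [← hc, vec, map_mul, Module.End.mul_apply]
  separates := fun _ _ hne => hS.separates_vec δ h2 hne

lemma IsRepSet.span_range_vec (hT : D.IsTransversal T) (hδ : ∀ s : S, D.Extends s (δ s)) :
    Submodule.span ℂ (Set.range (hS.vec δ)) = D.topSpace T := by
  apply le_antisymm
  · refine Submodule.span_le.mpr ?_
    rintro _ ⟨p, rfl⟩
    exact D.weil_mem_topSpace hT _ (D.E_mem_topSpace hT _ _ (hS.1 _ (hS.rep p.1).2))
  · refine Submodule.span_le.mpr ?_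
    rintro _ ⟨t, ⟨-, ht⟩, rfl⟩
    obtain ⟨s, ⟨hs, g, hg⟩, -⟩ := hS.2 t ht
    have h1 : t - (g⁻¹).1 s ∈ D.V0 := by
      have h3 := D.smul_mem_V0 (g⁻¹).1 hg
      have h4 : (g⁻¹).1 (g.1 t) = t := g.1.symm_apply_apply _
      rwa [map_sub, h4] at h3
    obtain ⟨F, hF, c, hc0, hc⟩ := D.exists_sum_E (hS.1 s hs) (hδ ⟨s, hs⟩)
    have hes : D.e s = c⁻¹ • ∑ φ ∈ F, D.E (δ ⟨s, hs⟩) φ s := by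
      rw [hc, inv_smul_smul₀ hc0]
    rw [SetLike.mem_coe, D.e_eq_smul_e h1, ← weil_e, hes, map_smul, map_sum]
    refine Submodule.smul_mem _ _ (Submodule.smul_mem _ _ (Submodule.sum_mem _ fun φ hφ => ?_))
    obtain ⟨o, a, -, ha⟩ := hS.exists_weil_E_eq δ g⁻¹ ⟨s, hs⟩ ⟨φ, hF φ hφ⟩
    change D.weil g⁻¹ (D.E (δ ⟨s, hs⟩) φ s) = _ at ha
    rw [ha]
    exact Submodule.smul_mem _ _ (Submodule.subset_span ⟨_, rfl⟩)

end System

end RepSet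

variable {D}

/-! ### The eigenspaces of the central involution -/

lemma coe_mul_coe_eq_neg_one_or_one (φ δ : D.NormOne →* ℂˣ) :
    (φ (-1) : ℂ) * (δ (-1) : ℂ) = 1 ∨ (φ (-1) : ℂ) * (δ (-1) : ℂ) = -1 := by
  rw [← mul_self_eq_one_iff, mul_mul_mul_comm, ← Units.val_mul, ← Units.val_mul, ← map_mul,
    ← map_mul]
  simp

lemma weil_mem_topEigen {T : Set V} (hT : D.IsTransversal T) (c : ℂ) (g : D.unitaryGroup) {w : D.X}
    (hw : w ∈ D.topEigen T c) : D.weil g w ∈ D.topEigen T c := by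
  refine ⟨D.weil_mem_topSpace hT g hw.1, ?_⟩
  have h1 := Module.End.mem_eigenspace_iff.mp hw.2
  rw [SetLike.mem_coe, Module.End.mem_eigenspace_iff, iota, weil_scalar_comm, ← iota, h1, map_smul]

section System

variable {T S : Set V} (hS : D.IsRepSet S) [Finite R] (δ : S → D.NormOne →* ℂˣ)

/-- The eigenvalue of the central involution on `vec p`. -/
def IsRepSet.sign (p : D.PrimClass × D.charGroup) : ℂ :=
  (p.2.1 (-1) : ℂ) * (δ (hS.rep p.1) (-1) : ℂ)

/-- Multiplying `φ` by a character in `G` with value `-1` at `-1` permutes the index set and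
reverses the sign. -/
lemma IsRepSet.ncard_sign_eq (h2 : IsUnit (2 : R)) :
    {p | hS.sign δ p = 1}.ncard = {p | hS.sign δ p = -1}.ncard := by
  obtain ⟨φ, hφ, hφ1⟩ := D.exists_charGroup_neg_one h2
  let e : D.PrimClass × D.charGroup ≃ D.PrimClass × D.charGroup :=
    (Equiv.refl _).prodCongr (Equiv.mulRight ⟨φ, hφ⟩)
  have he : ∀ p, hS.sign δ (e p) = -hS.sign δ p := by
    intro p
    change (((p.2.1 * φ) (-1) : ℂˣ) : ℂ) * _ = -((p.2.1 (-1) : ℂ) * _)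
    rw [MonoidHom.mul_apply, hφ1, mul_neg_one, Units.val_neg, neg_mul]
    rfl
  rw [← Set.ncard_image_of_injective _ e.injective]
  congr 1
  ext p
  rw [e.image_eq_preimage_symm]
  simp only [Set.mem_preimage, Set.mem_ofPred_eq]
  have h3 := he (e.symm p)
  rw [Equiv.apply_symm_apply] at h3
  rw [h3, neg_inj]

variable [Module.Free (RamExt R x) V] [Module.Finite (RamExt R x) V]

lemma IsRepSet.topEigen_eq (h2 : IsUnit (2 : R)) (hT : D.IsTransversal T)
    (hδ : ∀ s : S, D.Extends s (δ s)) (c : ℂ) :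
    D.topEigen T c = Submodule.span ℂ (hS.vec δ '' {p | hS.sign δ p = c}) := by
  have h1 := (hS.monomialSystem δ h2 hδ).span_inf_eigenspace (g := D.iota) (f := hS.sign δ)
    (hS.weil_scalar_vec δ (-1)) c
  rw [topEigen, ← hS.span_range_vec δ hT hδ]
  exact h1

include hS in
-- The index type is left free so that both ways of parametrizing the summands, with and without
-- `δ_s(ι) = 1`, are instances.
lemma IsRepSet.isInternalSum_topEigen (h2 : IsUnit (2 : R)) (hT : D.IsTransversal T)
    (hδ : ∀ s : S, D.Extends s (δ s)) {J : Type*} {j : J → S × D.charGroup}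
    (hj : Function.Injective j) {c : ℂ}
    (hc : ∀ i : S × D.charGroup, i ∈ Set.range j ↔ (i.2.1 (-1) : ℂ) * (δ i.1 (-1) : ℂ) = c) :
    IsInternalSum (fun a => (D.topSub (δ (j a).1) (j a).2 (j a).1).toSubmodule)
      (D.topEigen T c) := by
  have h1 := (hS.monomialSystem δ h2 hδ).isInternalSum hj
  have h3 : {p | (hS.monomialSystem δ h2 hδ).typ p ∈ Set.range j} = {p | hS.sign δ p = c} :=
    Set.ext fun p => hc (hS.rep p.1, p.2)
  rw [h3] at h1
  rw [hS.topEigen_eq δ h2 hT hδ]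
  exact h1

include hS in
lemma IsRepSet.finrank_topEigen (h2 : IsUnit (2 : R)) (hT : D.IsTransversal T)
    (hδ : ∀ s : S, D.Extends s (δ s)) {c : ℂ} (hc : c = 1 ∨ c = -1) :
    2 * Module.finrank ℂ (D.topEigen T c) = Module.finrank ℂ (D.topSpace T) := by
  have : Finite V := Module.finite_of_finite (RamExt R x)
  have hsum : {p | hS.sign δ p = 1}.ncard + {p | hS.sign δ p = -1}.ncard
      = (Set.univ : Set (D.PrimClass × D.charGroup)).ncard := by
    rw [← Set.ncard_union_eq]
    · congr 1
      exact Set.eq_univ_of_forall fun p => coe_mul_coe_eq_neg_one_or_one p.2.1 (δ (hS.rep p.1))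
    · rw [Set.disjoint_left]
      intro p hp hp'
      have h3 : (1 : ℂ) = -1 := hp.symm.trans hp'
      norm_num at h3
  have heq := hS.ncard_sign_eq δ h2
  have h1 := (hS.monomialSystem δ h2 hδ).finrank_span_image
  change ∀ O, Module.finrank ℂ (Submodule.span ℂ (hS.vec δ '' O)) = _ at h1
  have h3 := h1 Set.univ
  rw [Set.image_univ, hS.span_range_vec δ hT hδ] at h3
  rw [hS.topEigen_eq δ h2 hT hδ, h1, h3, ← hsum]
  rcases hc with rfl | rfl <;> omega

end System

end WeilData

end RamifiedWeil

end

/-! ### The theorem. -/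

open RamifiedWeil RamifiedWeil.WeilData in
theorem mainTheorem3 {R : Type*} [CommRing R] [IsLocalRing R] [IsPrincipalIdealRing R] [Finite R]
    (h2 : IsUnit (2 : R)) (x : R)
    {V : Type*} [AddCommGroup V] [Module (RamifiedWeil.RamExt R x) V]
    [Module.Free (RamifiedWeil.RamExt R x) V] [Module.Finite (RamifiedWeil.RamExt R x) V]
    (m q : ℕ) (hm : 1 ≤ m) (hV : Module.finrank (RamifiedWeil.RamExt R x) V = m)
    (hq : Nat.card (IsLocalRing.ResidueField R) = q)
    (D : RamifiedWeil.WeilData R x V)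
    (T S : Set V) (hT : D.IsTransversal T) (hST : S ⊆ T) (hS : D.IsRepSet S) :
    -- the extensions `δ_s` exist and can be chosen with `δ_s(ι) = 1`
    (∃ δ : S → D.NormOne →* ℂˣ, ∀ s : S, D.Extends s (δ s) ∧ δ s (-1) = 1) ∧
    ∀ δ : S → D.NormOne →* ℂˣ, (∀ s : S, D.Extends s (δ s)) →
      -- (a)
      (∃ τ : Subrepresentation D.weil, τ.toSubmodule = D.topSpace T ∧
        RamifiedWeil.IsMultiplicityFree τ.toRepresentation) ∧
      RamifiedWeil.IsInternalSum
        (fun p : S × D.charGroup => (D.topSub (δ p.1) p.2 p.1).toSubmodule) (D.topSpace T) ∧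
      (∀ (s : S) (φ : D.charGroup),
        (D.topSub (δ s) φ s).toRepresentation.IsIrreducible ∧
        RamifiedWeil.IsMonomial (D.topSub (δ s) φ s).toRepresentation) ∧
      -- (b)
      (∃ τ τ' : Subrepresentation D.weil,
        τ.toSubmodule = D.topEigen T 1 ∧ τ'.toSubmodule = D.topEigen T (-1)) ∧
      D.topEigen T 1 ⊓ D.topEigen T (-1) = ⊥ ∧
      D.topEigen T 1 ⊔ D.topEigen T (-1) = D.topSpace T ∧
      (Module.finrank ℂ (D.topEigen T 1) : ℚ)
        = ((q : ℚ) ^ (D.ell * m) - (q : ℚ) ^ ((D.ell - 1) * m)) / 2 ∧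
      (Module.finrank ℂ (D.topEigen T (-1)) : ℚ)
        = ((q : ℚ) ^ (D.ell * m) - (q : ℚ) ^ ((D.ell - 1) * m)) / 2 ∧
      -- decomposition of `Top^±` when `δ_s(ι) = 1` for all `s`
      ((∀ s : S, δ s (-1) = 1) →
        RamifiedWeil.IsInternalSum
          (fun p : S × {φ : D.charGroup // φ.1 (-1) = 1} =>
            (D.topSub (δ p.1) p.2.1 p.1).toSubmodule) (D.topEigen T 1) ∧
        RamifiedWeil.IsInternalSum
          (fun p : S × {φ : D.charGroup // φ.1 (-1) = -1} =>
            (D.topSub (δ p.1) p.2.1 p.1).toSubmodule) (D.topEigen T (-1))) ∧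
      -- decomposition of `Top^±` for an arbitrary choice of the `δ_s`
      RamifiedWeil.IsInternalSum
        (fun p : {p : S × D.charGroup // p.2.1 (-1) * δ p.1 (-1) = 1} =>
          (D.topSub (δ p.1.1) p.1.2 p.1.1).toSubmodule) (D.topEigen T 1) ∧
      RamifiedWeil.IsInternalSum
        (fun p : {p : S × D.charGroup // p.2.1 (-1) * δ p.1 (-1) = -1} =>
          (D.topSub (δ p.1.1) p.1.2 p.1.1).toSubmodule) (D.topEigen T (-1)) := by
  refine ⟨?_, fun δ hδ => ?_⟩
  · choose δ hδ using fun s : S => D.exists_extends h2 (hS.1 s s.2)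
    exact ⟨δ, hδ⟩
  have hdim : ∀ c : ℂ, c = 1 ∨ c = -1 → (Module.finrank ℂ (D.topEigen T c) : ℚ)
      = ((q : ℚ) ^ (D.ell * m) - (q : ℚ) ^ ((D.ell - 1) * m)) / 2 := by
    intro c hc
    have h1 := hS.finrank_topEigen δ h2 hT hδ hc
    rw [D.finrank_topSpace hT] at h1
    rw [eq_div_iff two_ne_zero, ← hq, ← hV, ← D.ncard_primitive hT, ← h1]
    push_cast
    ring
  -- A sign in `ℂˣ` treats both eigenvalues at once; `hneg` later matches its coercion with `-1 :
  -- ℂ`.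
  have hsub : ∀ ε : ℂˣ, (∀ s : S, δ s (-1) = 1) →
      IsInternalSum (fun p : S × {φ : D.charGroup // φ.1 (-1) = ε} =>
        (D.topSub (δ p.1) p.2.1 p.1).toSubmodule) (D.topEigen T ε) := by
    intro ε h1
    refine hS.isInternalSum_topEigen δ h2 hT hδ
      (j := fun p : S × {φ : D.charGroup // φ.1 (-1) = ε} => (p.1, p.2.1)) ?_ ?_
    · rintro ⟨s, φ⟩ ⟨s', φ'⟩ h
      obtain ⟨h3, h4⟩ := Prod.mk.inj h
      exact Prod.ext h3 (Subtype.ext h4)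
    · rintro ⟨s, φ⟩
      rw [h1 s, Units.val_one, mul_one, Units.val_inj]
      constructor
      · rintro ⟨⟨s', φ'⟩, h⟩
        rw [← congrArg Prod.snd h]
        exact φ'.2
      · intro h
        exact ⟨(s, ⟨φ, h⟩), rfl⟩
  have hgen : ∀ ε : ℂˣ, IsInternalSum
      (fun p : {p : S × D.charGroup // p.2.1 (-1) * δ p.1 (-1) = ε} =>
        (D.topSub (δ p.1.1) p.1.2 p.1.1).toSubmodule) (D.topEigen T ε) := by
    intro ε
    refine hS.isInternalSum_topEigen δ h2 hT hδ
      (j := fun p : {p : S × D.charGroup // p.2.1 (-1) * δ p.1 (-1) = ε} => p.1)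
      Subtype.val_injective fun i => ?_
    rw [Subtype.range_coe_subtype, ← Units.val_mul, Units.val_inj]
    exact Iff.rfl
  have hneg : ((-1 : ℂˣ) : ℂ) = -1 := by simp
  refine ⟨⟨⟨D.topSpace T, fun g _ hw => D.weil_mem_topSpace hT g hw⟩, rfl, ?_⟩, ?_,
    fun s φ => ⟨(hS.monomialSystem δ h2 hδ).isIrreducible (s, φ),
      (hS.monomialSystem δ h2 hδ).isMonomial (s, φ)⟩,
    ⟨⟨D.topEigen T 1, fun g _ hw => weil_mem_topEigen hT 1 g hw⟩,
      ⟨D.topEigen T (-1), fun g _ hw => weil_mem_topEigen hT (-1) g hw⟩, rfl, rfl⟩,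
    ?_, ?_, hdim 1 (Or.inl rfl), hdim (-1) (Or.inr rfl), fun h1 => ⟨?_, ?_⟩, ?_, ?_⟩
  · exact (hS.monomialSystem δ h2 hδ).isMultiplicityFree _ (hS.span_range_vec δ hT hδ).symm
  · have h1 := (hS.monomialSystem δ h2 hδ).isInternalSum (j := id) Function.injective_id
    rw [Set.range_id] at h1
    have h3 : hS.vec δ '' {p | (hS.monomialSystem δ h2 hδ).typ p ∈ Set.univ}
        = Set.range (hS.vec δ) := by
      simp
    rw [← hS.span_range_vec δ hT hδ, ← h3]
    exact h1
  · rw [eq_bot_iff]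
    rintro w ⟨hw, hw'⟩
    have h3 := Module.End.mem_eigenspace_iff.mp hw.2
    have h4 := Module.End.mem_eigenspace_iff.mp hw'.2
    rw [h3, ← sub_eq_zero, ← sub_smul, smul_eq_zero] at h4
    exact h4.resolve_left (by norm_num)
  · rw [hS.topEigen_eq δ h2 hT hδ, hS.topEigen_eq δ h2 hT hδ, ← Submodule.span_union,
      ← Set.image_union, ← hS.span_range_vec δ hT hδ, ← Set.image_univ]
    congr 2
    exact Set.eq_univ_of_forall fun p => coe_mul_coe_eq_neg_one_or_one p.2.1 (δ (hS.rep p.1))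
  · exact hsub 1 h1
  · have h3 := hsub (-1) h1
    rwa [hneg] at h3
  · exact hgen 1
  · have h3 := hgen (-1)
    rwa [hneg] at h3
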